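/- For a partition $\lambda$ of $n$ let $\chi^\lambda$ be the corresponding irreducible character of the symmetric group $S_n$. For $k,\ell\ge 0$ let $H(k,\ell;n)$ be the set of partitions $\mu=(\mu_1\ge\mu_2\ge\cdots)$ of $n$ with $\mu_{k+1}\le \ell$, and let $m_\lambda=m_\lambda(k,\ell)$ be the multiplicity of $\chi^\lambda$ in $\sum_{\mu\in H(k,\ell;n)}\chi^\mu\otimes\chi^\mu$. Let $HS_\lambda(t_1,\dots,t_a;u_1,\dots,u_b)$ be the hook Schur function, i.e. the generating function of the tableaux of shape $\lambda$ in the letters $t_1<\dots<t_a<u_1<\dots<u_b$ whose rows and columns weakly increase, with each $t_i$ occurring at most once in every column and each $u_j$ at most once in every row. Put $$P(k,\ell;a,b)=\sum_\lambda m_\lambda\, HS_\lambda(t_1,\dots,t_a;u_1,\dots,u_b),$$ the sum being over all partitions $\lambda$. Let $f(x)=P(1,1;0,1)$ and $g(x)=P(2,2;1,0)$, where $x$ denotes the single variable. Then $f$ and $g$ are the power series expansions at $0$ of the rational functions $$f(x)=\frac{1+x-x^2}{1-x^2},\qquad g(x)=\frac{1-x-x^2+2x^3-x^5+x^6}{(1-x)^2(1-x^2)^2}.$$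 If $h$ is either of these two rational functions, then there are no integer $e$ and no choice of sign for which $h(x^{-1})=\pm x^{e}h(x)$ holds as an identity of rational functions. -/

import Mathlib

open scoped LaurentSeries

noncomputable section

namespace SuperInvariants

/-- Partitions of `n`, as Young diagrams with `n` cells; the cell `(i, j)` lies in row `i` and
column `j`, both counted from `0`, and `μ.rowLen i` is the part `μ_{i+1}`. -/
abbrev Diagram (n : ℕ) : Type := {μ : YoungDiagram // μ.card = n}

theorem cells_subset {n : ℕ} (μ : Diagram n) :
    μ.1.cells ⊆ Finset.range n ×ˢ Finset.range n := by
  intro c hc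
  have hc' : (c.1, c.2) ∈ μ.1 := (YoungDiagram.mem_cells _).1 hc
  have h1 : c.2 < n := by
    have h := YoungDiagram.mem_iff_lt_rowLen.1 hc'
    rw [YoungDiagram.rowLen_eq_card] at h
    exact lt_of_lt_of_le h ((Finset.card_le_card (Finset.filter_subset _ _)).trans μ.2.le)
  have h2 : c.1 < n := by
    have h := YoungDiagram.mem_iff_lt_colLen.1 hc'
    rw [YoungDiagram.colLen_eq_card] at h
    exact lt_of_lt_of_le h ((Finset.card_le_card (Finset.filter_subset _ _)).trans μ.2.le)
  simp [h1, h2]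

instance (n : ℕ) : Finite (Diagram n) := by
  refine Finite.of_injective
    (fun μ : Diagram n =>
      (⟨μ.1.cells, Finset.mem_powerset.2 (cells_subset μ)⟩ :
        {s // s ∈ (Finset.range n ×ˢ Finset.range n).powerset})) ?_
  intro μ ν h
  exact Subtype.ext (YoungDiagram.ext (congrArg Subtype.val h))

instance (n : ℕ) : Fintype (Diagram n) := Fintype.ofFinite _

/-! ### Irreducible characters of the symmetric group -/

/-- A bijective filling of the diagram by `0, …, n - 1`. All fillings give isomorphic Specht
modules, so the choice does not affect the character. -/
def numbering {n : ℕ} (μ : Diagram n) : Fin n ≃ μ.1.cells :=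
  (μ.1.cells.equivFinOfCardEq μ.2).symm

/-- The subgroup of permutations that preserve every row of the filling. -/
def rowGroup {n : ℕ} (μ : Diagram n) : Subgroup (Equiv.Perm (Fin n)) where
  carrier := {g | ∀ i, (numbering μ (g i)).1.1 = (numbering μ i).1.1}
  one_mem' := fun _ => rfl
  mul_mem' := fun {a b} ha hb i => (ha (b i)).trans (hb i)
  inv_mem' := fun {a} ha i => by simpa using (ha (a⁻¹ i)).symm

/-- The subgroup of permutations that preserve every column of the filling. -/
def colGroup {n : ℕ} (μ : Diagram n) : Subgroup (Equiv.Perm (Fin n)) where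
  carrier := {g | ∀ i, (numbering μ (g i)).1.2 = (numbering μ i).1.2}
  one_mem' := fun _ => rfl
  mul_mem' := fun {a b} ha hb i => (ha (b i)).trans (hb i)
  inv_mem' := fun {a} ha i => by simpa using (ha (a⁻¹ i)).symm

open Classical in
/-- The Young symmetrizer `(∑ p) * (∑ sgn(q) q)`, with `p` in the row group and `q` in the column
group. -/
def youngSymmetrizer {n : ℕ} (μ : Diagram n) : MonoidAlgebra ℂ (Equiv.Perm (Fin n)) :=
  (∑ p : Equiv.Perm (Fin n) with p ∈ rowGroup μ, MonoidAlgebra.of ℂ _ p) *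
    ∑ q : Equiv.Perm (Fin n) with q ∈ colGroup μ,
      ((Equiv.Perm.sign q : ℤ) : ℂ) • MonoidAlgebra.of ℂ _ q

/-- The Specht module: the left ideal of the group algebra generated by the Young symmetrizer. -/
abbrev Specht {n : ℕ} (μ : Diagram n) : Ideal (MonoidAlgebra ℂ (Equiv.Perm (Fin n))) :=
  Ideal.span {youngSymmetrizer μ}

/-- The irreducible character `χ^μ` of the symmetric group. -/
def chi {n : ℕ} (μ : Diagram n) (g : Equiv.Perm (Fin n)) : ℂ :=
  (Representation.ofModule' (k := ℂ) (G := Equiv.Perm (Fin n)) (Specht μ)).character g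

/-! ### Multiplicities -/

/-- The hook `H(k, ℓ)`: partitions with `μ_{k+1} ≤ ℓ`. -/
def InHook (k ℓ : ℕ) (μ : YoungDiagram) : Prop := μ.rowLen k ≤ ℓ

open Classical in
/-- The character `∑ χ^μ ⊗ χ^μ`, summed over the partitions `μ` of `n` in `H(k, ℓ)`. -/
def hookCharacter (k ℓ n : ℕ) (g : Equiv.Perm (Fin n)) : ℂ :=
  ∑ μ : Diagram n with InHook k ℓ μ.1, chi μ g * chi μ g

/-- `m_lam`: the multiplicity of `χ^lam` in `∑ χ^μ ⊗ χ^μ`, as the inner product of characters. -/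
def multiplicity (k ℓ : ℕ) {n : ℕ} (lam : Diagram n) : ℂ :=
  (n.factorial : ℂ)⁻¹ * ∑ g : Equiv.Perm (Fin n), hookCharacter k ℓ n g * chi lam g⁻¹

/-! ### Hook Schur functions -/

/-- `(a, b)`-semistandard tableaux, with letters `t_1 < ⋯ < t_a < u_1 < ⋯ < u_b`: rows and columns
increase weakly, the letters `t_i` increase strictly down columns, and the letters `u_j` increase
strictly along rows. -/
def IsSemistandard {a b : ℕ} (lam : YoungDiagram) (T : lam.cells → Fin a ⊕ Fin b) : Prop :=
  (∀ c d : lam.cells, c.1.1 = d.1.1 → c.1.2 < d.1.2 →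
    toLex (T c) < toLex (T d) ∨ (T c = T d ∧ (T c).isLeft)) ∧
  (∀ c d : lam.cells, c.1.2 = d.1.2 → c.1.1 < d.1.1 →
    toLex (T c) < toLex (T d) ∨ (T c = T d ∧ (T c).isRight))

open Classical in
/-- The hook Schur function `HS_lam(t_1, …, t_a; u_1, …, u_b)`, with `t_i` the variable `inl i`
and `u_j` the variable `inr j`. It is homogeneous of degree `|lam|`. -/
def hookSchur (a b : ℕ) (lam : YoungDiagram) : MvPolynomial (Fin a ⊕ Fin b) ℂ :=
  ∑ T : lam.cells → Fin a ⊕ Fin b with IsSemistandard lam T, ∏ c, MvPolynomial.X (T c)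

/-! ### The series -/

/-- `P(k, ℓ; a, b) = ∑ m_lam HS_lam(t_1, …, t_a; u_1, …, u_b)`, summed over all partitions. By
homogeneity only the partitions of `n` contribute to a coefficient of total degree `n`. -/
def P (k ℓ a b : ℕ) : MvPowerSeries (Fin a ⊕ Fin b) ℂ := fun d =>
  ∑ lam : Diagram d.degree, multiplicity k ℓ lam * (hookSchur a b lam.1).coeff d

/-- `f(x) = P(1, 1; 0, 1)`, with `x` the only variable. -/
def f : PowerSeries ℂ :=
  PowerSeries.mk fun n => MvPowerSeries.coeff (Finsupp.single (Sum.inr 0) n) (P 1 1 0 1)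

/-- `g(x) = P(2, 2; 1, 0)`, with `x` the only variable. -/
def g : PowerSeries ℂ :=
  PowerSeries.mk fun n => MvPowerSeries.coeff (Finsupp.single (Sum.inl 0) n) (P 2 2 1 0)

/-- `h(x⁻¹) = ± x^e h(x)` for some integer `e` and some sign, as rational functions. -/
def SatisfiesFunctionalEquation (h : RatFunc ℂ) : Prop :=
  ∃ e : ℤ, RatFunc.eval RatFunc.C (RatFunc.X⁻¹) h = RatFunc.X ^ e * h ∨
    RatFunc.eval RatFunc.C (RatFunc.X⁻¹) h = -(RatFunc.X ^ e * h)

end SuperInvariants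

end

/-!
Only one diagram of each size carries a tableau in a single letter: the column for the letter `u`,
the row for the letter `t`. So the coefficient of `x ^ n` in `f` is the multiplicity of the sign
character in `∑ χ^μ ⊗ χ^μ` over `H(1, 1; n)`, and in `g` it is the multiplicity of the trivial
character in `∑ χ^μ ⊗ χ^μ` over `H(2, 2; n)`.

The characters `χ^μ` are real and orthonormal, and twisting by the sign turns `χ^μ` into the
character of the transposed diagram. Hence `f` counts the self-conjugate partitions in `H(1, 1)`
and `g` counts all partitions in `H(2, 2)` (`multiplicity_of_col`, `multiplicity_of_row`). All of
this is read off from Young symmetrizers `c`. The character of the left ideal `A c` of the group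
algebra `A` is `κ⁻¹ ∑ h, c(h⁻¹ g⁻¹ h)` when `c² = κ c` (`character_span_singleton`), so the inner
product of two such characters is governed by the products `c k c'`. By Young's combinatorial
lemmas these vanish for different shapes (`symmetrizer_mul_mul_eq_zero`) and are multiples of `c`
for `c' = c` (`symmetrizer_mul_mul_self`). Both rest on a dominance inequality for fillings in which
no two entries share a row of one tableau and a column of another (`IsTableau.card_lt_row_le`) and
on its case of equality (`IsTableau.of_card_lt_row_eq`).

For the counts, a nonempty partition without the cell `(1, 1)` is a hook, determined by its arm and
leg, and self-conjugate when these agree; a partition in `H(2, 2)` with that cell is a `2 × 2`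
square together with two independent partitions into at most two parts. This gives
`f = 1 + x / (1 - x²)` and `g = 1 + x / (1 - x)² + x⁴ / ((1 - x)² (1 - x²)²)`.

In both cases the denominator is palindromic up to sign, so a functional equation would make the
reversed numerator equal to the numerator up to sign and a power of `x`. The values of the two at
`1` force the sign, and those at `2` then exclude every exponent.
-/

namespace SuperInvariants

/-! ### Characters of left ideals of a group algebra -/

section GroupAlgebra

variable {G : Type*} [Group G]

/-- The map `x ↦ g x c` of the group algebra. -/
noncomputable def translateMul (g : G) (c : MonoidAlgebra ℂ G) :
    MonoidAlgebra ℂ G →ₗ[ℂ] MonoidAlgebra ℂ G :=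
  LinearMap.mulLeft ℂ (MonoidAlgebra.single g 1) ∘ₗ LinearMap.mulRight ℂ c

theorem translateMul_apply (g : G) (c x : MonoidAlgebra ℂ G) :
    translateMul g c x = MonoidAlgebra.single g 1 * (x * c) := rfl

/-- A basis of the group algebra: the group elements. -/
noncomputable def groupBasis : Module.Basis G ℂ (MonoidAlgebra ℂ G) :=
  Module.Basis.ofRepr (MonoidAlgebra.coeffLinearEquiv ℂ)

variable [Fintype G]

/-- The class function `g ↦ ∑ x(h⁻¹ g h)` attached to an element `x` of the group algebra. -/
noncomputable def classTrace (x : MonoidAlgebra ℂ G) (g : G) : ℂ :=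
  ∑ h : G, x.coeff (h⁻¹ * g * h)

theorem coeff_mul_eq_sum_left (x y : MonoidAlgebra ℂ G) (g : G) :
    (x * y).coeff g = ∑ a : G, x.coeff a * y.coeff (a⁻¹ * g) := by
  rw [MonoidAlgebra.coeff_mul_apply_left, Finsupp.sum_fintype]
  simp

theorem coeff_mul_eq_sum_right (x y : MonoidAlgebra ℂ G) (g : G) :
    (x * y).coeff g = ∑ a : G, x.coeff (g * a⁻¹) * y.coeff a := by
  rw [MonoidAlgebra.coeff_mul_apply_right, Finsupp.sum_fintype]
  simp

theorem classTrace_mul_comm (x y : MonoidAlgebra ℂ G) (g : G) :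
    classTrace (x * y) g = classTrace (y * x) g := by
  simp only [classTrace]
  simp_rw [coeff_mul_eq_sum_left x y, coeff_mul_eq_sum_right y x]
  rw [Finset.sum_comm]
  conv_rhs => rw [Finset.sum_comm]
  refine Finset.sum_congr rfl fun a _ => ?_
  rw [← Equiv.sum_comp (Equiv.mulRight a⁻¹)]
  refine Finset.sum_congr rfl fun h _ => ?_
  simp [mul_comm, mul_assoc]

theorem classTrace_conj (x : MonoidAlgebra ℂ G) (g k : G) :
    classTrace x (k * g * k⁻¹) = classTrace x g := by
  simp only [classTrace]
  rw [← Equiv.sum_comp (Equiv.mulLeft k)]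
  refine Finset.sum_congr rfl fun h _ => ?_
  simp [mul_assoc]

/-- The inner product of two class functions, as a sum of identity coefficients of `x k y k⁻¹`. -/
theorem sum_classTrace_mul (x y : MonoidAlgebra ℂ G) :
    ∑ g : G, classTrace x g * classTrace y g⁻¹ =
      Fintype.card G * ∑ k : G,
        (x * MonoidAlgebra.single k 1 * y * MonoidAlgebra.single k⁻¹ 1).coeff 1 := by
  have key : ∀ k : G, (x * MonoidAlgebra.single k 1 * y * MonoidAlgebra.single k⁻¹ 1).coeff 1 =
      ∑ g : G, x.coeff g * y.coeff (k⁻¹ * g⁻¹ * k) := by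
    intro k
    rw [mul_assoc, mul_assoc, coeff_mul_eq_sum_left]
    simp [MonoidAlgebra.coeff_mul_single_apply, MonoidAlgebra.coeff_single_mul_apply, mul_assoc]
  simp_rw [key]
  have h1 : ∀ g : G, classTrace x g * classTrace y g⁻¹ =
      ∑ h : G, x.coeff (h⁻¹ * g * h) * classTrace y (h⁻¹ * g * h)⁻¹ := by
    intro g
    rw [classTrace, Finset.sum_mul]
    refine Finset.sum_congr rfl fun h _ => ?_
    have := classTrace_conj y g⁻¹ h⁻¹
    rw [← this]
    simp [mul_assoc]
  simp_rw [h1]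
  rw [Finset.sum_comm]
  have h2 : ∀ h : G, ∑ g : G, x.coeff (h⁻¹ * g * h) * classTrace y (h⁻¹ * g * h)⁻¹ =
      ∑ g : G, x.coeff g * classTrace y g⁻¹ := by
    intro h
    rw [← Equiv.sum_comp (MulAut.conj h⁻¹).toEquiv (fun g => x.coeff g * classTrace y g⁻¹)]
    refine Finset.sum_congr rfl fun g _ => ?_
    simp
  simp_rw [h2]
  rw [Finset.sum_const, Finset.card_univ, nsmul_eq_mul]
  congr 1
  rw [Finset.sum_comm]
  simp [classTrace, Finset.mul_sum]

theorem sum_classTrace_mul_eq_zero {x y : MonoidAlgebra ℂ G}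
    (h : ∀ k : G, x * MonoidAlgebra.single k 1 * y = 0) :
    ∑ g : G, classTrace x g * classTrace y g⁻¹ = 0 := by
  rw [sum_classTrace_mul]
  simp [h]

/-- If `c A c` is spanned by `c` and `c² = κ c`, the class function of `c` has squared norm
`|G| κ²`: with `c k c = φ(k) c` one has `∑ c(k) φ(k) c = c³`. -/
theorem sum_classTrace_mul_self {c : MonoidAlgebra ℂ G} {κ : ℂ} (hc : c ≠ 0)
    (hκ : c * c = κ • c)
    (h : ∀ k : G, ∃ z : ℂ, c * MonoidAlgebra.single k 1 * c = z • c) :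
    ∑ g : G, classTrace c g * classTrace c g⁻¹ = Fintype.card G * κ ^ 2 := by
  rw [sum_classTrace_mul]
  congr 1
  choose φ hφ using h
  have h3 : (∑ k : G, φ k * c.coeff k) • c = (κ ^ 2) • c := by
    have e : c = ∑ k : G, c.coeff k • MonoidAlgebra.single k 1 := by
      conv_lhs => rw [← MonoidAlgebra.sum_coeff_single c]
      rw [Finsupp.sum_fintype _ _ (by simp)]
      simp
    have e2 : c * c * c = (κ ^ 2) • c := by
      rw [hκ, smul_mul_assoc, hκ, smul_smul, sq]
    rw [← e2]
    conv_rhs => rw [mul_assoc]; arg 2; arg 1; rw [e]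
    simp only [Finset.sum_mul, Finset.mul_sum, Finset.sum_smul, smul_mul_assoc, mul_smul_comm]
    refine Finset.sum_congr rfl fun k _ => ?_
    rw [← mul_assoc, hφ, smul_smul, mul_comm]
  rw [← smul_left_injective ℂ hc h3]
  refine Finset.sum_congr rfl fun k _ => ?_
  rw [hφ]
  simp [MonoidAlgebra.coeff_mul_single_apply]

theorem trace_translateMul (g : G) (c : MonoidAlgebra ℂ G) :
    LinearMap.trace ℂ _ (translateMul g c) = classTrace c g⁻¹ := by
  classical
  rw [LinearMap.trace_eq_matrix_trace ℂ groupBasis, Matrix.trace, classTrace]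
  refine Finset.sum_congr rfl fun h _ => ?_
  have hb : groupBasis h = (MonoidAlgebra.single h 1 : MonoidAlgebra ℂ G) := rfl
  have hr : ∀ x : MonoidAlgebra ℂ G, groupBasis.repr x = x.coeff := fun _ => rfl
  rw [Matrix.diag_apply, LinearMap.toMatrix_apply, hb, hr, translateMul_apply]
  simp [MonoidAlgebra.coeff_single_mul_apply, mul_assoc]

/-- A quasi-idempotent with nonzero coefficient at the identity is not nilpotent: right
multiplication by it has nonzero trace. -/
theorem quasiIdempotent_ne_zero {c : MonoidAlgebra ℂ G} {κ : ℂ} (hκ : c * c = κ • c)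
    (h1 : c.coeff 1 = 1) : κ ≠ 0 := by
  rintro rfl
  have hn : IsNilpotent (translateMul (1 : G) c) := by
    refine ⟨2, ?_⟩
    refine LinearMap.ext fun x => ?_
    rw [pow_two, Module.End.mul_apply, translateMul_apply, translateMul_apply]
    rw [zero_smul] at hκ
    simp [← MonoidAlgebra.one_def, mul_assoc, hκ]
  have ht := (LinearMap.isNilpotent_trace_of_isNilpotent hn).eq_zero
  rw [trace_translateMul] at ht
  simp [classTrace, h1] at ht

/-- The character of the left ideal generated by a quasi-idempotent `c`, computed as the trace of
`x ↦ κ⁻¹ g x c` on the whole group algebra. -/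
theorem character_span_singleton {c : MonoidAlgebra ℂ G} {κ : ℂ} (hκ : c * c = κ • c)
    (h0 : κ ≠ 0) (g : G) :
    (Representation.ofModule' (k := ℂ) (G := G) (Ideal.span {c})).character g =
      κ⁻¹ * classTrace c g⁻¹ := by
  set V : Ideal (MonoidAlgebra ℂ G) := Ideal.span {c} with hV
  have hfin : Module.Finite ℂ (MonoidAlgebra ℂ G) := Module.Finite.of_basis groupBasis
  let ι : V →ₗ[ℂ] MonoidAlgebra ℂ G := (V.subtype).restrictScalars ℂ
  have hfinV : Module.Finite ℂ V := Module.Finite.of_injective ι Subtype.val_injective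
  let p : MonoidAlgebra ℂ G →ₗ[ℂ] V :=
    { toFun := fun x => ⟨(κ⁻¹ • x) * c, Ideal.mul_mem_left _ _ (Ideal.subset_span rfl)⟩
      map_add' := fun x y => by ext1; simp [add_mul]
      map_smul' := fun z x => by
        ext1
        change (κ⁻¹ • (z • x)) * c = z • ((κ⁻¹ • x) * c)
        rw [smul_comm, smul_mul_assoc] }
  let ρ : V →ₗ[ℂ] V := Representation.ofModule' (k := ℂ) (G := G) V g
  have hρ : ∀ v : V, ((ρ v : V) : MonoidAlgebra ℂ G) =
      MonoidAlgebra.single g 1 * (v : MonoidAlgebra ℂ G) := by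
    intro v
    change ((MonoidAlgebra.of ℂ G g • v : V) : MonoidAlgebra ℂ G) = _
    rfl
  have hp : ∀ v : V, p v = v := by
    intro v
    ext1
    obtain ⟨a, ha⟩ := Ideal.mem_span_singleton'.1 v.2
    change (κ⁻¹ • (v : MonoidAlgebra ℂ G)) * c = v
    rw [← ha, smul_mul_assoc, mul_assoc, hκ, mul_smul_comm, smul_smul, inv_mul_cancel₀ h0, one_smul]
  have e1 : ρ = (ρ ∘ₗ p) ∘ₗ ι := by
    refine LinearMap.ext fun v => ?_
    change ρ v = ρ (p v)
    rw [hp]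
  have e2 : ι ∘ₗ (ρ ∘ₗ p) = κ⁻¹ • translateMul g c := by
    refine LinearMap.ext fun x => ?_
    change ((ρ (p x) : V) : MonoidAlgebra ℂ G) = _
    rw [hρ, LinearMap.smul_apply, translateMul_apply]
    change _ * ((κ⁻¹ • x) * c) = _
    rw [smul_mul_assoc, mul_smul_comm]
  change LinearMap.trace ℂ V ρ = _
  rw [e1, LinearMap.trace_comp_comm', e2, map_smul, trace_translateMul, smul_eq_mul]

end GroupAlgebra

/-! ### Tableaux and Young's combinatorial lemma -/

/-- The functions `r`, `c` are the row and column coordinates of a bijective filling of `μ`. -/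
structure IsTableau {n : ℕ} (μ : YoungDiagram) (r c : Fin n → ℕ) : Prop where
  inj : ∀ i j, r i = r j → c i = c j → i = j
  mem : ∀ i, (r i, c i) ∈ μ
  surj : ∀ x ∈ μ, ∃ i, (r i, c i) = x

namespace IsTableau

variable {n : ℕ} {μ ν : YoungDiagram} {r c r' c' : Fin n → ℕ}

theorem transpose (h : IsTableau μ r c) : IsTableau μ.transpose c r where
  inj i j h1 h2 := h.inj i j h2 h1
  mem i := by simpa [YoungDiagram.mem_transpose] using h.mem i
  surj x hx := by
    obtain ⟨i, hi⟩ := h.surj x.swap (YoungDiagram.mem_transpose.1 hx)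
    exact ⟨i, by rw [← Prod.swap_swap x, ← hi]; rfl⟩

theorem comp_perm (h : IsTableau μ r c) (g : Equiv.Perm (Fin n)) :
    IsTableau μ (r ∘ g) (c ∘ g) where
  inj i j h1 h2 := g.injective (h.inj _ _ h1 h2)
  mem i := h.mem _
  surj x hx := by
    obtain ⟨i, hi⟩ := h.surj x hx
    exact ⟨g⁻¹ i, by simpa using hi⟩

/-- Two tableaux of the same shape differ by a permutation of the entries. -/
theorem exists_perm (h : IsTableau μ r c) (h' : IsTableau μ r' c') :
    ∃ p : Equiv.Perm (Fin n), r ∘ p = r' ∧ c ∘ p = c' := by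
  choose p hp using fun i => h.surj _ (h'.mem i)
  have hinj : Function.Injective p := by
    intro i j hij
    have e : (r' i, c' i) = (r' j, c' j) := by rw [← hp, ← hp, hij]
    exact h'.inj i j (congrArg Prod.fst e) (congrArg Prod.snd e)
  refine ⟨Equiv.ofBijective p (Finite.injective_iff_bijective.1 hinj), ?_, ?_⟩
  · exact funext fun i => congrArg Prod.fst (hp i)
  · exact funext fun i => congrArg Prod.snd (hp i)

/-- The number of entries in the first `k` rows of a given column. -/
theorem card_lt_row_col (h : IsTableau μ r c) (k j : ℕ) :
    (Finset.univ.filter fun i => r i < k ∧ c i = j).card = min k (μ.colLen j) := by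
  rw [← Finset.card_range (min k (μ.colLen j))]
  refine Finset.card_bij (fun i _ => r i) ?_ ?_ ?_
  · intro i hi
    simp only [Finset.mem_filter, Finset.mem_univ, true_and] at hi
    have := YoungDiagram.mem_iff_lt_colLen.1 (h.mem i)
    rw [hi.2] at this
    simp [hi.1, this]
  · intro i hi i' hi' e
    simp only [Finset.mem_filter, Finset.mem_univ, true_and] at hi hi'
    exact h.inj i i' e (hi.2.trans hi'.2.symm)
  · intro a ha
    simp only [Finset.mem_range, lt_min_iff] at ha
    obtain ⟨i, hi⟩ := h.surj (a, j) (YoungDiagram.mem_iff_lt_colLen.2 ha.2)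
    obtain ⟨h1, h2⟩ := Prod.mk.inj hi
    exact ⟨i, by simp [h1, h2, ha.1], h1⟩

theorem card_col (h : IsTableau μ r c) (j : ℕ) :
    (Finset.univ.filter fun i => c i = j).card = μ.colLen j := by
  rw [← min_eq_right (le_refl (μ.colLen j)), ← h.card_lt_row_col]
  congr 1
  ext i
  simp only [Finset.mem_filter, Finset.mem_univ, true_and]
  refine ⟨fun e => ⟨?_, e⟩, fun e => e.2⟩
  rw [← e]
  exact YoungDiagram.mem_iff_lt_colLen.1 (h.mem i)

theorem card_row (h : IsTableau μ r c) (a : ℕ) :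
    (Finset.univ.filter fun i => r i = a).card = μ.rowLen a := by
  rw [h.transpose.card_col, YoungDiagram.colLen_transpose]

/-- If no two entries share a row under `r` and a column of the tableau `(r', c')`, then each column
holds at most as many entries of the first `k` rows of `r` as of the first `k` rows of `r'`. -/
theorem card_lt_row_col_le (h : IsTableau ν r' c') (hinj : ∀ i j, r i = r j → c' i = c' j → i = j)
    (k j : ℕ) : (Finset.univ.filter fun i => r i < k ∧ c' i = j).card ≤
      (Finset.univ.filter fun i => r' i < k ∧ c' i = j).card := by
  rw [h.card_lt_row_col, le_min_iff]
  constructor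
  · rw [← Finset.card_range k]
    refine Finset.card_le_card_of_injOn r ?_ ?_
    · intro i hi
      simp only [Finset.coe_filter, Finset.mem_univ, true_and, Set.mem_ofPred_eq] at hi
      simpa using hi.1
    · intro i hi i' hi' e
      simp only [Finset.coe_filter, Finset.mem_univ, true_and, Set.mem_ofPred_eq] at hi hi'
      exact hinj i i' e (hi.2.trans hi'.2.symm)
  · rw [← h.card_col]
    exact Finset.card_le_card (Finset.monotone_filter_right _ fun i _ hi => hi.2)

theorem card_lt_row_eq_sum (r s : Fin n → ℕ) (k : ℕ) :
    (Finset.univ.filter fun i => r i < k).card =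
      ∑ j ∈ Finset.univ.image s, (Finset.univ.filter fun i => r i < k ∧ s i = j).card := by
  rw [Finset.card_eq_sum_card_fiberwise (f := s) (t := Finset.univ.image s)
    (fun i _ => by simp)]
  simp [Finset.filter_filter]

/-- The dominance inequality, summed over the columns. -/
theorem card_lt_row_le (h : IsTableau ν r' c')
    (hinj : ∀ i j, r i = r j → c' i = c' j → i = j) (k : ℕ) :
    (Finset.univ.filter fun i => r i < k).card ≤ (Finset.univ.filter fun i => r' i < k).card := by
  rw [card_lt_row_eq_sum r c', card_lt_row_eq_sum r' c']
  exact Finset.sum_le_sum fun j _ => h.card_lt_row_col_le hinj k j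

/-- In the case of equality in the dominance inequality, `(r, c')` is itself a tableau. -/
theorem of_card_lt_row_eq (h : IsTableau ν r' c')
    (hinj : ∀ i j, r i = r j → c' i = c' j → i = j)
    (heq : ∀ k, (Finset.univ.filter fun i => r i < k).card =
      (Finset.univ.filter fun i => r' i < k).card) : IsTableau ν r c' := by
  have hcol : ∀ k i, (Finset.univ.filter fun i' => r i' < k ∧ c' i' = c' i).card =
      min k (ν.colLen (c' i)) := by
    intro k i
    have e := heq k
    rw [card_lt_row_eq_sum r c', card_lt_row_eq_sum r' c',
      Finset.sum_eq_sum_iff_of_le fun j _ => h.card_lt_row_col_le hinj k j] at e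
    rw [e _ (by simp), h.card_lt_row_col]
  have hstep : ∀ k i, (Finset.univ.filter fun i' => r i' < k + 1 ∧ c' i' = c' i).card =
      (Finset.univ.filter fun i' => r i' < k ∧ c' i' = c' i).card +
      (Finset.univ.filter fun i' => r i' = k ∧ c' i' = c' i).card := by
    intro k i
    rw [← Finset.card_union_of_disjoint]
    · congr 1
      ext i'
      simp only [Finset.mem_filter, Finset.mem_univ, true_and, Finset.mem_union]
      rw [Nat.lt_succ_iff_lt_or_eq]
      tauto
    · rw [Finset.disjoint_left]
      intro i' h1 h2
      simp only [Finset.mem_filter, Finset.mem_univ, true_and] at h1 h2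
      omega
  refine ⟨hinj, fun i => ?_, fun x hx => ?_⟩
  · rw [YoungDiagram.mem_iff_lt_colLen]
    by_contra! hlt
    have e := hstep (r i) i
    rw [hcol, hcol] at e
    have : 0 < (Finset.univ.filter fun i' => r i' = r i ∧ c' i' = c' i).card :=
      Finset.card_pos.2 ⟨i, by simp⟩
    omega
  · obtain ⟨i, hi⟩ := h.surj x hx
    have e := hstep x.1 i
    have hc : c' i = x.2 := by rw [← hi]
    rw [hcol, hcol, hc] at e
    have := YoungDiagram.mem_iff_lt_colLen.1 (show (x.1, x.2) ∈ ν from hx)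
    have hpos : 0 < (Finset.univ.filter fun i' => r i' = x.1 ∧ c' i' = x.2).card := by omega
    obtain ⟨i', hi'⟩ := Finset.card_pos.1 hpos
    simp only [Finset.mem_filter, Finset.mem_univ, true_and] at hi'
    exact ⟨i', by rw [hi'.1, hi'.2]⟩

theorem eq_of_card_lt_row_eq (h : IsTableau μ r c) (h' : IsTableau ν r' c')
    (heq : ∀ k, (Finset.univ.filter fun i => r i < k).card =
      (Finset.univ.filter fun i => r' i < k).card) : μ = ν := by
  have hstep : ∀ (s : Fin n → ℕ) k, (Finset.univ.filter fun i => s i < k + 1).card =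
      (Finset.univ.filter fun i => s i < k).card + (Finset.univ.filter fun i => s i = k).card := by
    intro s k
    rw [← Finset.card_union_of_disjoint]
    · congr 1
      ext i
      simp only [Finset.mem_filter, Finset.mem_univ, true_and, Finset.mem_union]
      omega
    · rw [Finset.disjoint_left]
      intro i h1 h2
      simp only [Finset.mem_filter, Finset.mem_univ, true_and] at h1 h2
      omega
  have hrow : ∀ a, μ.rowLen a = ν.rowLen a := by
    intro a
    have h1 := hstep r a
    have h2 := hstep r' a
    rw [heq, heq, h.card_row] at h1
    rw [h'.card_row] at h2
    omega
  refine YoungDiagram.ext (Finset.ext fun x => ?_)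
  rw [YoungDiagram.mem_cells, YoungDiagram.mem_cells]
  change (x.1, x.2) ∈ μ ↔ (x.1, x.2) ∈ ν
  rw [YoungDiagram.mem_iff_lt_rowLen, YoungDiagram.mem_iff_lt_rowLen, hrow]

/-- For tableaux of different shapes, either the rows of the first collide with the columns of the
second, or the columns of the first with the rows of the second. -/
theorem collision_of_ne (h : IsTableau μ r c) (h' : IsTableau ν r' c') (hne : μ ≠ ν)
    (g g' : Equiv.Perm (Fin n)) :
    (∃ i j, i ≠ j ∧ r i = r j ∧ c' (g i) = c' (g j)) ∨
      ∃ i j, i ≠ j ∧ c i = c j ∧ r' (g' i) = r' (g' j) := by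
  by_contra! hcon
  obtain ⟨h1, h2⟩ := hcon
  refine hne (h.eq_of_card_lt_row_eq h' fun k => ?_)
  have hp : ∀ g : Equiv.Perm (Fin n), (Finset.univ.filter fun i => r' (g i) < k).card =
      (Finset.univ.filter fun i => r' i < k).card := by
    intro g
    refine Finset.card_bij (fun i _ => g i) (fun i hi => by simpa using hi)
      (fun i _ j _ e => g.injective e) fun i hi => ⟨g⁻¹ i, by simpa using hi, by simp⟩
  refine le_antisymm ?_ ?_
  · refine ((h'.comp_perm g).card_lt_row_le (r := r) (fun i j e1 e2 => ?_) k).trans (hp g).le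
    by_contra hij
    exact h1 i j hij e1 e2
  · refine (hp g').ge.trans (h.card_lt_row_le (r := r' ∘ g') (fun i j e1 e2 => ?_) k)
    by_contra hij
    exact h2 i j hij e2 e1

end IsTableau

/-! ### Young symmetrizers -/

section Symmetrizers

variable {n : ℕ}

open Classical in
/-- The sum of the permutations that preserve the function `r`. -/
noncomputable def stabSum (r : Fin n → ℕ) : MonoidAlgebra ℂ (Equiv.Perm (Fin n)) :=
  ∑ p ∈ Finset.univ.filter (fun p : Equiv.Perm (Fin n) => r ∘ p = r),
    MonoidAlgebra.single p 1

open Classical in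
/-- The sum of the permutations that preserve the function `c`, weighted by their signs. -/
noncomputable def stabSignSum (c : Fin n → ℕ) : MonoidAlgebra ℂ (Equiv.Perm (Fin n)) :=
  ∑ q ∈ Finset.univ.filter (fun q : Equiv.Perm (Fin n) => c ∘ q = c),
    MonoidAlgebra.single q ((Equiv.Perm.sign q : ℤ) : ℂ)

theorem comp_mul_eq {α : Type*} {r : Fin n → α} {p q : Equiv.Perm (Fin n)} (hp : r ∘ p = r) :
    r ∘ (p * q : Equiv.Perm (Fin n)) = r ∘ q := by
  rw [Equiv.Perm.coe_mul, ← Function.comp_assoc, hp]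

theorem comp_inv_eq {α : Type*} {r : Fin n → α} {p : Equiv.Perm (Fin n)} (hp : r ∘ p = r) :
    r ∘ (p⁻¹ : Equiv.Perm (Fin n)) = r := by
  conv_lhs => rw [← hp]
  ext i
  simp

theorem stabSum_mul_single {r : Fin n → ℕ} {p : Equiv.Perm (Fin n)} (hp : r ∘ p = r) :
    stabSum r * MonoidAlgebra.single p 1 = stabSum r := by
  classical
  simp only [stabSum, Finset.sum_mul, MonoidAlgebra.single_mul_single, mul_one]
  refine Finset.sum_equiv (Equiv.mulRight p) (fun q => ?_) (fun q _ => rfl)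
  simp only [Finset.mem_filter, Finset.mem_univ, true_and, Equiv.coe_mulRight]
  refine ⟨fun hq => by rw [comp_mul_eq hq, hp], fun hq => ?_⟩
  have : q = q * p * p⁻¹ := by simp
  rw [this, comp_mul_eq hq, comp_inv_eq hp]

theorem single_mul_stabSum {r : Fin n → ℕ} {p : Equiv.Perm (Fin n)} (hp : r ∘ p = r) :
    MonoidAlgebra.single p 1 * stabSum r = stabSum r := by
  classical
  simp only [stabSum, Finset.mul_sum, MonoidAlgebra.single_mul_single, mul_one]
  refine Finset.sum_equiv (Equiv.mulLeft p) (fun q => ?_) (fun q _ => rfl)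
  simp only [Finset.mem_filter, Finset.mem_univ, true_and, Equiv.coe_mulLeft]
  rw [comp_mul_eq hp]

theorem sign_mul_sign_self (g : Equiv.Perm (Fin n)) :
    ((Equiv.Perm.sign g : ℤ) : ℂ) * ((Equiv.Perm.sign g : ℤ) : ℂ) = 1 := by
  rw [← Int.cast_mul, ← Units.val_mul, Int.units_mul_self]
  simp

theorem single_sign_mul {g q : Equiv.Perm (Fin n)} :
    (MonoidAlgebra.single (g * q) ((Equiv.Perm.sign q : ℤ) : ℂ)) =
      ((Equiv.Perm.sign g : ℤ) : ℂ) •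
        MonoidAlgebra.single (g * q) ((Equiv.Perm.sign (g * q) : ℤ) : ℂ) := by
  rw [MonoidAlgebra.smul_single]
  congr 1
  rw [Equiv.Perm.sign_mul, Units.val_mul, Int.cast_mul, smul_eq_mul, ← mul_assoc,
    sign_mul_sign_self, one_mul]

theorem single_mul_stabSignSum {c : Fin n → ℕ} {q : Equiv.Perm (Fin n)} (hq : c ∘ q = c) :
    MonoidAlgebra.single q 1 * stabSignSum c = ((Equiv.Perm.sign q : ℤ) : ℂ) • stabSignSum c := by
  classical
  simp only [stabSignSum, Finset.mul_sum, MonoidAlgebra.single_mul_single, one_mul,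
    Finset.smul_sum]
  refine Finset.sum_equiv (Equiv.mulLeft q) (fun p => ?_) (fun p _ => single_sign_mul)
  simp only [Finset.mem_filter, Finset.mem_univ, true_and, Equiv.coe_mulLeft]
  rw [comp_mul_eq hq]

theorem stabSum_comp (r : Fin n → ℕ) (g : Equiv.Perm (Fin n)) :
    MonoidAlgebra.single g 1 * stabSum (r ∘ g) = stabSum r * MonoidAlgebra.single g 1 := by
  classical
  simp only [stabSum, Finset.mul_sum, Finset.sum_mul, MonoidAlgebra.single_mul_single, one_mul]
  refine Finset.sum_equiv (MulAut.conj g).toEquiv (fun p => ?_) (fun p _ => by simp)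
  simp only [Finset.mem_filter, Finset.mem_univ, true_and, funext_iff,
    Function.comp_apply]
  exact ⟨fun h i => by simpa using h (g⁻¹ i), fun h i => by simpa using h (g i)⟩

theorem stabSignSum_comp (r : Fin n → ℕ) (g : Equiv.Perm (Fin n)) :
    MonoidAlgebra.single g 1 * stabSignSum (r ∘ g) =
      stabSignSum r * MonoidAlgebra.single g 1 := by
  classical
  simp only [stabSignSum, Finset.mul_sum, Finset.sum_mul, MonoidAlgebra.single_mul_single, one_mul,
    mul_one]
  refine Finset.sum_equiv (MulAut.conj g).toEquiv (fun p => ?_) (fun p _ => ?_)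
  · simp only [Finset.mem_filter, Finset.mem_univ, true_and, funext_iff,
      Function.comp_apply]
    exact ⟨fun h i => by simpa using h (g⁻¹ i), fun h i => by simpa using h (g i)⟩
  · have := sign_mul_sign_self g
    simp
    linear_combination -((Equiv.Perm.sign p : ℤ) : ℂ) * this

theorem comp_swap_eq {r : Fin n → ℕ} {i j : Fin n} (h : r i = r j) :
    r ∘ (Equiv.swap i j : Equiv.Perm (Fin n)) = r := by
  ext k
  simp only [Function.comp_apply, Equiv.swap_apply_def]
  split_ifs with h1 h2
  · rw [h1, h]
  · rw [h2, h]
  · rfl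

theorem eq_zero_of_eq_neg_self {V : Type*} [AddCommGroup V] [Module ℂ V] {x : V} (h : x = -x) :
    x = 0 := by
  have h2 : (2 : ℂ) • x = 0 := by
    rw [two_smul]
    exact eq_neg_iff_add_eq_zero.1 h
  exact (smul_eq_zero.1 h2).resolve_left two_ne_zero

/-- The transposition of the two colliding letters can be moved across the product, at the cost of
a sign. -/
theorem stabSum_mul_stabSignSum_eq_zero {r c : Fin n → ℕ} {i j : Fin n} (hij : i ≠ j)
    (hr : r i = r j) (hc : c i = c j) : stabSum r * stabSignSum c = 0 := by
  have h := stabSum_mul_single (comp_swap_eq hr)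
  have e : stabSum r * stabSignSum c = -(stabSum r * stabSignSum c) := by
    conv_lhs => rw [← h, mul_assoc, single_mul_stabSignSum (comp_swap_eq hc)]
    simp [Equiv.Perm.sign_swap hij]
  exact eq_zero_of_eq_neg_self e

theorem stabSignSum_mul_single {c : Fin n → ℕ} {q : Equiv.Perm (Fin n)} (hq : c ∘ q = c) :
    stabSignSum c * MonoidAlgebra.single q 1 = ((Equiv.Perm.sign q : ℤ) : ℂ) • stabSignSum c := by
  rw [← stabSignSum_comp, hq, single_mul_stabSignSum hq]

theorem stabSignSum_mul_stabSum_eq_zero {r c : Fin n → ℕ} {i j : Fin n} (hij : i ≠ j)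
    (hr : r i = r j) (hc : c i = c j) : stabSignSum c * stabSum r = 0 := by
  have h := single_mul_stabSum (comp_swap_eq hr)
  have e : stabSignSum c * stabSum r = -(stabSignSum c * stabSum r) := by
    conv_lhs => rw [← h, ← mul_assoc, stabSignSum_mul_single (comp_swap_eq hc)]
    simp [Equiv.Perm.sign_swap hij]
  exact eq_zero_of_eq_neg_self e

theorem stabSum_mul_single_mul_stabSignSum_eq_zero {r c : Fin n → ℕ} {g : Equiv.Perm (Fin n)}
    {i j : Fin n} (hij : i ≠ j) (hr : r i = r j) (hc : c (g⁻¹ i) = c (g⁻¹ j)) :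
    stabSum r * MonoidAlgebra.single g 1 * stabSignSum c = 0 := by
  have : c = (c ∘ (g⁻¹ : Equiv.Perm (Fin n))) ∘ g := by ext; simp
  rw [mul_assoc, this, stabSignSum_comp, ← mul_assoc,
    stabSum_mul_stabSignSum_eq_zero hij hr hc, zero_mul]

theorem stabSignSum_mul_single_mul_stabSum_eq_zero {r c : Fin n → ℕ} {g : Equiv.Perm (Fin n)}
    {i j : Fin n} (hij : i ≠ j) (hr : r (g⁻¹ i) = r (g⁻¹ j)) (hc : c i = c j) :
    stabSignSum c * MonoidAlgebra.single g 1 * stabSum r = 0 := by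
  have : r = (r ∘ (g⁻¹ : Equiv.Perm (Fin n))) ∘ g := by ext; simp
  rw [mul_assoc, this, stabSum_comp, ← mul_assoc,
    stabSignSum_mul_stabSum_eq_zero hij hr hc, zero_mul]

/-- By linearity it suffices to test `x A y = 0` on group elements. -/
theorem mul_mul_eq_zero {G : Type*} [Group G] {x y : MonoidAlgebra ℂ G}
    (h : ∀ g, x * MonoidAlgebra.single g 1 * y = 0) (a : MonoidAlgebra ℂ G) : x * a * y = 0 := by
  induction a using MonoidAlgebra.induction_linear with
  | zero => simp
  | add a b ha hb => rw [mul_add, add_mul, ha, hb, add_zero]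
  | single g z =>
    have : (MonoidAlgebra.single g z : MonoidAlgebra ℂ G) = z • MonoidAlgebra.single g 1 := by
      simp
    rw [this, mul_smul_comm, smul_mul_assoc, h, smul_zero]

theorem exists_mul_mul_eq_smul {G : Type*} [Group G] {x y c : MonoidAlgebra ℂ G}
    (h : ∀ g, ∃ z : ℂ, x * MonoidAlgebra.single g 1 * y = z • c) (a : MonoidAlgebra ℂ G) :
    ∃ z : ℂ, x * a * y = z • c := by
  induction a using MonoidAlgebra.induction_linear with
  | zero => exact ⟨0, by simp⟩
  | add a b ha hb =>
    obtain ⟨u, hu⟩ := ha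
    obtain ⟨v, hv⟩ := hb
    exact ⟨u + v, by rw [mul_add, add_mul, hu, hv, add_smul]⟩
  | single g z =>
    obtain ⟨u, hu⟩ := h g
    have : (MonoidAlgebra.single g z : MonoidAlgebra ℂ G) = z • MonoidAlgebra.single g 1 := by
      simp
    exact ⟨z * u, by rw [this, mul_smul_comm, smul_mul_assoc, hu, smul_smul]⟩

/-- The Young symmetrizer of the tableau with row and column coordinates `r` and `c`. -/
noncomputable def symmetrizer (r c : Fin n → ℕ) : MonoidAlgebra ℂ (Equiv.Perm (Fin n)) :=
  stabSum r * stabSignSum c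

variable {μ ν : YoungDiagram} {r c r' c' : Fin n → ℕ}

/-- Young symmetrizers of different shapes are orthogonal. -/
theorem symmetrizer_mul_mul_eq_zero (h : IsTableau μ r c) (h' : IsTableau ν r' c') (hne : μ ≠ ν)
    (a : MonoidAlgebra ℂ (Equiv.Perm (Fin n))) :
    symmetrizer r c * a * symmetrizer r' c' = 0 := by
  by_cases hcol : ∀ g : Equiv.Perm (Fin n), ∃ i j, i ≠ j ∧ r i = r j ∧ c' (g i) = c' (g j)
  · have := mul_mul_eq_zero (x := stabSum r) (y := stabSignSum c') (fun g => by
      obtain ⟨i, j, hij, h1, h2⟩ := hcol g⁻¹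
      exact stabSum_mul_single_mul_stabSignSum_eq_zero hij h1 h2) (stabSignSum c * a * stabSum r')
    simpa [symmetrizer, mul_assoc] using this
  · push Not at hcol
    obtain ⟨g, hg⟩ := hcol
    have := mul_mul_eq_zero (x := stabSignSum c) (y := stabSum r') (fun g' => by
      rcases h.collision_of_ne h' hne g g'⁻¹ with ⟨i, j, hij, h1, h2⟩ | ⟨i, j, hij, h1, h2⟩
      · exact absurd h2 (hg i j hij h1)
      · exact stabSignSum_mul_single_mul_stabSum_eq_zero hij h2 h1) a
    calc symmetrizer r c * a * symmetrizer r' c'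
        = stabSum r * (stabSignSum c * a * stabSum r') * stabSignSum c' := by
          simp [symmetrizer, mul_assoc]
      _ = 0 := by rw [this]; simp

/-- Young's lemma: if the rows of the tableau do not collide with its columns moved by `g`, then
`g` is a product of a row and a column permutation. -/
theorem stabSum_mul_single_mul_stabSignSum (h : IsTableau μ r c) (g : Equiv.Perm (Fin n)) :
    ∃ z : ℂ, stabSum r * MonoidAlgebra.single g 1 * stabSignSum c = z • symmetrizer r c := by
  by_cases hcol : ∃ i j, i ≠ j ∧ r i = r j ∧ c (g⁻¹ i) = c (g⁻¹ j)
  · obtain ⟨i, j, hij, h1, h2⟩ := hcol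
    exact ⟨0, by rw [stabSum_mul_single_mul_stabSignSum_eq_zero hij h1 h2, zero_smul]⟩
  · push Not at hcol
    have hinj : ∀ i j, r i = r j → (c ∘ (g⁻¹ : Equiv.Perm (Fin n))) i =
        (c ∘ (g⁻¹ : Equiv.Perm (Fin n))) j → i = j := by
      intro i j h1 h2
      by_contra hij
      exact hcol i j hij h1 h2
    have ht : IsTableau μ r (c ∘ (g⁻¹ : Equiv.Perm (Fin n))) := by
      refine (h.comp_perm g⁻¹).of_card_lt_row_eq hinj fun k => ?_
      refine Finset.card_bij (fun i _ => g i) (fun i hi => by simpa using hi)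
        (fun i _ j _ e => g.injective e) fun i hi => ⟨g⁻¹ i, by simpa using hi, by simp⟩
    obtain ⟨p, hp1, hp2⟩ := ht.exists_perm h
    have hq : c ∘ (g⁻¹ * p : Equiv.Perm (Fin n)) = c := by
      rw [Equiv.Perm.coe_mul, ← Function.comp_assoc, hp2]
    refine ⟨((Equiv.Perm.sign (g⁻¹ * p)⁻¹ : ℤ) : ℂ), ?_⟩
    have hg : (MonoidAlgebra.single g 1 : MonoidAlgebra ℂ (Equiv.Perm (Fin n))) =
        MonoidAlgebra.single p 1 * MonoidAlgebra.single (g⁻¹ * p)⁻¹ 1 := by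
      rw [MonoidAlgebra.single_mul_single]
      simp
    rw [hg, ← mul_assoc, stabSum_mul_single hp1, mul_assoc,
      single_mul_stabSignSum (comp_inv_eq hq), mul_smul_comm, symmetrizer]

theorem symmetrizer_mul_mul_self (h : IsTableau μ r c)
    (a : MonoidAlgebra ℂ (Equiv.Perm (Fin n))) :
    ∃ z : ℂ, symmetrizer r c * a * symmetrizer r c = z • symmetrizer r c := by
  obtain ⟨z, hz⟩ := exists_mul_mul_eq_smul (stabSum_mul_single_mul_stabSignSum h)
    (stabSignSum c * a * stabSum r)
  exact ⟨z, by rw [← hz]; simp [symmetrizer, mul_assoc]⟩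

/-- The row and the column group of a tableau meet in the identity only. -/
theorem coeff_one_symmetrizer (h : IsTableau μ r c) : (symmetrizer r c).coeff 1 = 1 := by
  classical
  rw [symmetrizer, stabSum, stabSignSum, Finset.sum_mul_sum, MonoidAlgebra.coeff_sum,
    Finset.sum_apply', Finset.sum_eq_single 1]
  · rw [MonoidAlgebra.coeff_sum, Finset.sum_apply', Finset.sum_eq_single 1]
    · simp [MonoidAlgebra.single_mul_single]
    · intro q _ hq
      simp [MonoidAlgebra.single_mul_single, hq]
    · simp
  · intro p hp hp1
    rw [MonoidAlgebra.coeff_sum, Finset.sum_apply']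
    refine Finset.sum_eq_zero fun q hq => ?_
    simp only [Finset.mem_filter, Finset.mem_univ, true_and] at hp hq
    rw [MonoidAlgebra.single_mul_single, MonoidAlgebra.coeff_single, Finsupp.single_apply,
      if_neg]
    intro hpq
    refine hp1 (Equiv.ext fun i => h.inj _ _ (congrFun hp i) ?_)
    rw [eq_inv_of_mul_eq_one_left hpq]
    exact congrFun (comp_inv_eq hq) i
  · simp

/-- The Young symmetrizer is quasi-idempotent. -/
theorem exists_symmetrizer_mul_self (h : IsTableau μ r c) :
    ∃ κ : ℂ, κ ≠ 0 ∧ symmetrizer r c * symmetrizer r c = κ • symmetrizer r c := by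
  obtain ⟨κ, hκ⟩ := symmetrizer_mul_mul_self h 1
  rw [mul_one] at hκ
  exact ⟨κ, quasiIdempotent_ne_zero hκ (coeff_one_symmetrizer h), hκ⟩

/-- Tableaux of the same shape have conjugate symmetrizers. -/
theorem classTrace_symmetrizer_eq (h : IsTableau μ r c) (h' : IsTableau μ r' c')
    (g : Equiv.Perm (Fin n)) :
    classTrace (symmetrizer r c) g = classTrace (symmetrizer r' c') g := by
  obtain ⟨p, rfl, rfl⟩ := h.exists_perm h'
  have e : MonoidAlgebra.single p 1 * symmetrizer (r ∘ p) (c ∘ p) =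
      symmetrizer r c * MonoidAlgebra.single p 1 := by
    rw [symmetrizer, ← mul_assoc, stabSum_comp, mul_assoc, stabSignSum_comp, ← mul_assoc,
      symmetrizer]
  have e2 : symmetrizer r c = MonoidAlgebra.single p 1 * symmetrizer (r ∘ p) (c ∘ p) *
      MonoidAlgebra.single p⁻¹ 1 := by
    rw [e, mul_assoc, MonoidAlgebra.single_mul_single]
    simp [← MonoidAlgebra.one_def]
  rw [e2, classTrace_mul_comm, ← mul_assoc, MonoidAlgebra.single_mul_single]
  simp [← MonoidAlgebra.one_def]

/-- Twisting by the sign exchanges rows and columns: it turns `stabSum r * stabSignSum c` into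
`stabSignSum r * stabSum c`, and class traces do not see the order of the factors. -/
theorem sign_mul_classTrace_symmetrizer (r c : Fin n → ℕ) (g : Equiv.Perm (Fin n)) :
    ((Equiv.Perm.sign g : ℤ) : ℂ) * classTrace (symmetrizer r c) g =
      classTrace (symmetrizer c r) g := by
  classical
  rw [symmetrizer, symmetrizer, classTrace_mul_comm (stabSum c), classTrace, classTrace,
    Finset.mul_sum]
  refine Finset.sum_congr rfl fun h _ => ?_
  have hs : Equiv.Perm.sign g = Equiv.Perm.sign (h⁻¹ * g * h) := by
    rw [Equiv.Perm.sign_mul, mul_comm, ← Equiv.Perm.sign_mul]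
    simp
  rw [hs]
  generalize h⁻¹ * g * h = k
  rw [stabSum, stabSignSum, stabSum, stabSignSum, Finset.sum_mul_sum, Finset.sum_mul_sum]
  simp only [MonoidAlgebra.coeff_sum, Finset.sum_apply',
    Finset.mul_sum, MonoidAlgebra.single_mul_single, MonoidAlgebra.coeff_single,
    Finsupp.single_apply]
  refine Finset.sum_congr rfl fun p _ => Finset.sum_congr rfl fun q _ => ?_
  split_ifs with hk
  · rw [← hk, Equiv.Perm.sign_mul, Units.val_mul, Int.cast_mul, one_mul, mul_one, mul_assoc,
      sign_mul_sign_self, mul_one]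
  · simp

end Symmetrizers

/-! ### Orthogonality of the irreducible characters -/

section Characters

variable {n : ℕ}

/-- The row coordinate of each entry in the chosen filling of `μ`. -/
noncomputable def rowFn (μ : Diagram n) (i : Fin n) : ℕ := (numbering μ i).1.1

/-- The column coordinate of each entry in the chosen filling of `μ`. -/
noncomputable def colFn (μ : Diagram n) (i : Fin n) : ℕ := (numbering μ i).1.2

theorem isTableau_numbering (μ : Diagram n) : IsTableau μ.1 (rowFn μ) (colFn μ) where
  inj i j h1 h2 := (numbering μ).injective (Subtype.ext (Prod.ext h1 h2))
  mem i := (YoungDiagram.mem_cells _).1 (numbering μ i).2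
  surj x hx := ⟨(numbering μ).symm ⟨x, (YoungDiagram.mem_cells _).2 hx⟩, by
    simp [rowFn, colFn]⟩

theorem youngSymmetrizer_eq (μ : Diagram n) :
    youngSymmetrizer μ = symmetrizer (rowFn μ) (colFn μ) := by
  classical
  rw [youngSymmetrizer, symmetrizer, stabSum, stabSignSum]
  congr 1
  · refine Finset.sum_congr (Finset.filter_congr fun p _ => ?_) fun p _ => rfl
    exact funext_iff.symm
  · refine Finset.sum_congr (Finset.filter_congr fun p _ => ?_) fun p _ => ?_
    · exact funext_iff.symm
    · simp [MonoidAlgebra.of_apply]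

/-- Class functions on the symmetric group do not distinguish a permutation from its inverse, which
has the same cycle type. -/
theorem classTrace_inv (x : MonoidAlgebra ℂ (Equiv.Perm (Fin n))) (g : Equiv.Perm (Fin n)) :
    classTrace x g⁻¹ = classTrace x g := by
  obtain ⟨k, hk⟩ := isConj_iff.1
    (Equiv.Perm.isConj_iff_cycleType_eq.2 (Equiv.Perm.cycleType_inv g).symm)
  rw [← hk, classTrace_conj]

/-- The character `χ^μ` in terms of the coefficients of the Young symmetrizer. -/
theorem exists_chi_eq (μ : Diagram n) : ∃ κ : ℂ, κ ≠ 0 ∧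
    symmetrizer (rowFn μ) (colFn μ) * symmetrizer (rowFn μ) (colFn μ) =
      κ • symmetrizer (rowFn μ) (colFn μ) ∧
    ∀ g, chi μ g = κ⁻¹ * classTrace (symmetrizer (rowFn μ) (colFn μ)) g := by
  obtain ⟨κ, h0, hκ⟩ := exists_symmetrizer_mul_self (isTableau_numbering μ)
  refine ⟨κ, h0, hκ, fun g => ?_⟩
  have h := character_span_singleton hκ h0 g
  rw [classTrace_inv, ← youngSymmetrizer_eq] at h
  rw [← youngSymmetrizer_eq]
  exact h

theorem sum_chi_mul_chi (μ : Diagram n) :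
    ∑ g : Equiv.Perm (Fin n), chi μ g * chi μ g = n.factorial := by
  obtain ⟨κ, h0, hκ, hchi⟩ := exists_chi_eq μ
  have ht := isTableau_numbering μ
  have hne : symmetrizer (rowFn μ) (colFn μ) ≠ 0 := by
    intro h
    have := coeff_one_symmetrizer ht
    simp [h] at this
  have key := sum_classTrace_mul_self hne hκ fun k => symmetrizer_mul_mul_self ht _
  simp_rw [classTrace_inv] at key
  calc ∑ g : Equiv.Perm (Fin n), chi μ g * chi μ g
      = κ⁻¹ ^ 2 * ∑ g, classTrace (symmetrizer (rowFn μ) (colFn μ)) g *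
          classTrace (symmetrizer (rowFn μ) (colFn μ)) g := by
        rw [Finset.mul_sum]
        refine Finset.sum_congr rfl fun g _ => ?_
        rw [hchi]
        ring
    _ = n.factorial := by
        rw [key, Fintype.card_perm, Fintype.card_fin]
        field_simp

open Classical in
theorem sum_sign_mul_chi_mul_chi (μ : Diagram n) :
    ∑ g : Equiv.Perm (Fin n), ((Equiv.Perm.sign g : ℤ) : ℂ) * (chi μ g * chi μ g) =
      if μ.1.transpose = μ.1 then (n.factorial : ℂ) else 0 := by
  obtain ⟨κ, h0, hκ, hchi⟩ := exists_chi_eq μ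
  have ht := isTableau_numbering μ
  have e : ∀ g, ((Equiv.Perm.sign g : ℤ) : ℂ) * (chi μ g * chi μ g) =
      chi μ g * (κ⁻¹ * classTrace (symmetrizer (colFn μ) (rowFn μ)) g) := by
    intro g
    rw [← sign_mul_classTrace_symmetrizer, hchi]
    ring
  simp_rw [e]
  split_ifs with hT
  · have ht' := ht.transpose
    rw [hT] at ht'
    rw [← sum_chi_mul_chi μ]
    refine Finset.sum_congr rfl fun g _ => ?_
    rw [classTrace_symmetrizer_eq ht' ht, ← hchi]
  · have key := sum_classTrace_mul_eq_zero fun k =>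
      symmetrizer_mul_mul_eq_zero ht ht.transpose (Ne.symm hT) (MonoidAlgebra.single k 1)
    simp_rw [classTrace_inv] at key
    simp_rw [hchi]
    refine Eq.trans ?_ (mul_zero (κ⁻¹ ^ 2))
    rw [← key, Finset.mul_sum]
    refine Finset.sum_congr rfl fun g _ => ?_
    ring

/-- If the coefficients of the Young symmetrizer form a linear character, that is `χ^μ`. -/
theorem chi_eq_of_coeff (μ : Diagram n) (ε : Equiv.Perm (Fin n) →* ℤˣ)
    (h : ∀ g, (symmetrizer (rowFn μ) (colFn μ)).coeff g = ((ε g : ℤ) : ℂ))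
    (g : Equiv.Perm (Fin n)) : chi μ g = ((ε g : ℤ) : ℂ) := by
  obtain ⟨κ, h0, hκ, hchi⟩ := exists_chi_eq μ
  have hκ' : κ = n.factorial := by
    have := congrArg (fun x => x.coeff 1) hκ
    simp only [coeff_mul_eq_sum_left, h, MonoidAlgebra.coeff_smul_apply, map_one] at this
    simpa [← Int.cast_mul, ← Units.val_mul, Fintype.card_perm] using this.symm
  rw [hchi, classTrace]
  have : ∀ k : Equiv.Perm (Fin n), (symmetrizer (rowFn μ) (colFn μ)).coeff (k⁻¹ * g * k) =
      ((ε g : ℤ) : ℂ) := by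
    intro k
    rw [h, map_mul, mul_comm, ← map_mul]
    simp
  simp_rw [this]
  rw [Finset.sum_const, Finset.card_univ, Fintype.card_perm, Fintype.card_fin, nsmul_eq_mul,
    ← mul_assoc, ← hκ', inv_mul_cancel₀ h0, one_mul]

theorem stabSum_of_const {r : Fin n → ℕ} (h : ∀ i, r i = 0) (g : Equiv.Perm (Fin n)) :
    (stabSum r).coeff g = 1 := by
  classical
  obtain rfl : r = fun _ => 0 := funext h
  have : ∀ p : Equiv.Perm (Fin n), (fun _ : Fin n => 0) ∘ p = fun _ => (0 : ℕ) := fun _ => rfl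
  simp [stabSum, MonoidAlgebra.coeff_sum, Finsupp.single_apply, this]

theorem stabSignSum_of_const {r : Fin n → ℕ} (h : ∀ i, r i = 0) (g : Equiv.Perm (Fin n)) :
    (stabSignSum r).coeff g = ((Equiv.Perm.sign g : ℤ) : ℂ) := by
  classical
  obtain rfl : r = fun _ => 0 := funext h
  have : ∀ p : Equiv.Perm (Fin n), (fun _ : Fin n => 0) ∘ p = fun _ => (0 : ℕ) := fun _ => rfl
  simp [stabSignSum, MonoidAlgebra.coeff_sum, Finsupp.single_apply, this]

theorem filter_comp_eq_of_injective {r : Fin n → ℕ} (h : Function.Injective r) :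
    (Finset.univ.filter fun p : Equiv.Perm (Fin n) => r ∘ p = r) = {1} := by
  ext p
  simp only [Finset.mem_filter, Finset.mem_univ, true_and, Finset.mem_singleton]
  refine ⟨fun hp => Equiv.ext fun i => h (congrFun hp i), ?_⟩
  rintro rfl
  rfl

theorem stabSum_of_injective {r : Fin n → ℕ} (h : Function.Injective r) : stabSum r = 1 := by
  classical
  rw [stabSum, filter_comp_eq_of_injective h]
  simp [MonoidAlgebra.one_def]

theorem stabSignSum_of_injective {r : Fin n → ℕ} (h : Function.Injective r) :
    stabSignSum r = 1 := by
  classical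
  rw [stabSignSum, filter_comp_eq_of_injective h]
  simp [MonoidAlgebra.one_def]

/-- The one-row partition gives the trivial character. -/
theorem chi_of_row {μ : Diagram n} (h : ∀ x ∈ μ.1, x.1 = 0) (g : Equiv.Perm (Fin n)) :
    chi μ g = 1 := by
  have ht := isTableau_numbering μ
  have h0 : ∀ i, rowFn μ i = 0 := fun i => h _ (ht.mem i)
  rw [chi_eq_of_coeff μ 1]
  · simp
  · intro k
    rw [symmetrizer, stabSignSum_of_injective fun i j hij => ht.inj i j (by rw [h0, h0]) hij,
      mul_one, stabSum_of_const h0]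
    simp

/-- The one-column partition gives the sign character. -/
theorem chi_of_col {μ : Diagram n} (h : ∀ x ∈ μ.1, x.2 = 0) (g : Equiv.Perm (Fin n)) :
    chi μ g = ((Equiv.Perm.sign g : ℤ) : ℂ) := by
  have ht := isTableau_numbering μ
  have h0 : ∀ i, colFn μ i = 0 := fun i => h _ (ht.mem i)
  rw [chi_eq_of_coeff μ Equiv.Perm.sign]
  intro k
  rw [symmetrizer, stabSum_of_injective fun i j hij => ht.inj i j hij (by rw [h0, h0]),
    one_mul, stabSignSum_of_const h0]

open Classical in
/-- By orthonormality, each `μ` in the hook contains the trivial character once in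
`χ^μ ⊗ χ^μ`. -/
theorem multiplicity_of_row (k l : ℕ) {lam : Diagram n} (h : ∀ x ∈ lam.1, x.1 = 0) :
    multiplicity k l lam = (Finset.univ.filter fun μ : Diagram n => InHook k l μ.1).card := by
  simp only [multiplicity, hookCharacter, chi_of_row h, mul_one]
  rw [Finset.sum_comm]
  simp_rw [sum_chi_mul_chi]
  rw [Finset.sum_const, nsmul_eq_mul, mul_comm, mul_assoc,
    mul_inv_cancel₀ (Nat.cast_ne_zero.2 n.factorial_ne_zero), mul_one]

open Classical in
/-- The sign character occurs in `χ^μ ⊗ χ^μ` exactly when `μ` is self-conjugate. -/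
theorem multiplicity_of_col (k l : ℕ) {lam : Diagram n} (h : ∀ x ∈ lam.1, x.2 = 0) :
    multiplicity k l lam = (Finset.univ.filter fun μ : Diagram n =>
      InHook k l μ.1 ∧ μ.1.transpose = μ.1).card := by
  simp only [multiplicity, hookCharacter, chi_of_col h, Equiv.Perm.sign_inv, Finset.sum_mul]
  rw [Finset.sum_comm]
  simp_rw [mul_comm (_ * _), sum_sign_mul_chi_mul_chi]
  rw [← Finset.sum_filter, Finset.sum_const, nsmul_eq_mul, mul_comm, mul_assoc,
    mul_inv_cancel₀ (Nat.cast_ne_zero.2 n.factorial_ne_zero), mul_one, Finset.filter_filter]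

end Characters

/-! ### Hook Schur functions in one variable -/

open Classical in
/-- With a single letter, the only candidate for a semistandard tableau is the constant one. -/
theorem coeff_hookSchur_of_unique {a b : ℕ} {s : Fin a ⊕ Fin b} (hs : ∀ t, t = s)
    {lam : YoungDiagram} {d : Fin a ⊕ Fin b →₀ ℕ} (hd : d = Finsupp.single s lam.card) :
    (hookSchur a b lam).coeff d = if IsSemistandard lam (fun _ => s) then 1 else 0 := by
  have hT : ∀ T : lam.cells → Fin a ⊕ Fin b, T = fun _ => s := fun T => funext fun c => hs _
  have hu : (Finset.univ : Finset (lam.cells → Fin a ⊕ Fin b)) = {fun _ => s} := by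
    ext T
    simp [hT T]
  rw [hookSchur, hu, Finset.filter_singleton]
  split_ifs with h
  · rw [Finset.sum_singleton, Finset.prod_const, Finset.card_univ, Fintype.card_coe,
      MvPolynomial.coeff_X_pow, if_pos hd.symm]
  · simp

theorem isSemistandard_inl_iff (lam : YoungDiagram) :
    IsSemistandard lam (fun _ => (Sum.inl 0 : Fin 1 ⊕ Fin 0)) ↔ ∀ x ∈ lam, x.1 = 0 := by
  constructor
  · rintro ⟨-, h⟩ ⟨i, j⟩ hx
    by_contra hi
    have h0 : (0, j) ∈ lam := lam.up_left_mem (Nat.zero_le i) le_rfl hx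
    have := h ⟨(0, j), (YoungDiagram.mem_cells _).2 h0⟩ ⟨(i, j), (YoungDiagram.mem_cells _).2 hx⟩
      rfl (Nat.pos_of_ne_zero hi)
    simp at this
  · intro h
    refine ⟨fun c d _ _ => Or.inr ⟨rfl, rfl⟩, fun c d _ hlt => ?_⟩
    have := h d.1 ((YoungDiagram.mem_cells _).1 d.2)
    omega

theorem isSemistandard_inr_iff (lam : YoungDiagram) :
    IsSemistandard lam (fun _ => (Sum.inr 0 : Fin 0 ⊕ Fin 1)) ↔ ∀ x ∈ lam, x.2 = 0 := by
  constructor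
  · rintro ⟨h, -⟩ ⟨i, j⟩ hx
    by_contra hj
    have h0 : (i, 0) ∈ lam := lam.up_left_mem le_rfl (Nat.zero_le j) hx
    have := h ⟨(i, 0), (YoungDiagram.mem_cells _).2 h0⟩ ⟨(i, j), (YoungDiagram.mem_cells _).2 hx⟩
      rfl (Nat.pos_of_ne_zero hj)
    simp at this
  · intro h
    refine ⟨fun c d _ hlt => ?_, fun c d _ _ => Or.inr ⟨rfl, rfl⟩⟩
    have := h d.1 ((YoungDiagram.mem_cells _).1 d.2)
    omega

/-- The partition `(n)`. -/
def rowDiagram (n : ℕ) : YoungDiagram where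
  cells := {0} ×ˢ Finset.range n
  isLowerSet := by
    rintro ⟨i, j⟩ ⟨i', j'⟩ h hx
    simp only [Prod.mk_le_mk] at h
    simp at hx ⊢
    omega

theorem mem_rowDiagram {n : ℕ} {x : ℕ × ℕ} : x ∈ rowDiagram n ↔ x.1 = 0 ∧ x.2 < n := by
  obtain ⟨i, j⟩ := x
  rw [← YoungDiagram.mem_cells]
  simp [rowDiagram, eq_comm, and_comm]

theorem card_rowDiagram (n : ℕ) : (rowDiagram n).card = n := by
  simp [YoungDiagram.card, rowDiagram]

theorem eq_rowDiagram {n : ℕ} {lam : YoungDiagram} (hn : lam.card = n)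
    (h : ∀ x ∈ lam, x.1 = 0) : lam = rowDiagram n := by
  have hc : lam.cells = lam.row 0 := by
    ext x
    rw [YoungDiagram.mem_row_iff, YoungDiagram.mem_cells]
    exact ⟨fun hx => ⟨hx, h x hx⟩, fun hx => hx.1⟩
  have hr : lam.rowLen 0 = n := by rw [YoungDiagram.rowLen_eq_card, ← hc, ← hn]
  apply YoungDiagram.ext
  rw [hc, YoungDiagram.row_eq_prod, hr]
  rfl

theorem card_transpose (μ : YoungDiagram) : μ.transpose.card = μ.card := by
  simp [YoungDiagram.card, YoungDiagram.transpose]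

theorem eq_transpose_rowDiagram {n : ℕ} {lam : YoungDiagram} (hn : lam.card = n)
    (h : ∀ x ∈ lam, x.2 = 0) : lam = (rowDiagram n).transpose := by
  rw [← YoungDiagram.transpose_eq_iff_eq_transpose]
  refine eq_rowDiagram ((card_transpose lam).trans hn) fun x hx => ?_
  exact h _ (YoungDiagram.mem_transpose.1 hx)

open Classical in
/-- The coefficients of `g` count the partitions in the hook `H(2, 2)`. -/
theorem coeff_g (n : ℕ) : PowerSeries.coeff n g =
    (Finset.univ.filter fun μ : Diagram n => InHook 2 2 μ.1).card := by
  rw [g, PowerSeries.coeff_mk]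
  set d : Fin 1 ⊕ Fin 0 →₀ ℕ := Finsupp.single (Sum.inl 0) n with hd
  have hdeg : d.degree = n := by simp [hd]
  change ∑ lam : Diagram d.degree, multiplicity 2 2 lam * (hookSchur 1 0 lam.1).coeff d = _
  have e : ∀ lam : Diagram d.degree, (hookSchur 1 0 lam.1).coeff d =
      if lam.1 = rowDiagram d.degree then 1 else 0 := by
    intro lam
    rw [coeff_hookSchur_of_unique (s := Sum.inl 0)
      (fun t => by rcases t with t | t <;> fin_cases t; rfl)
      (hd.trans (by rw [lam.2.trans hdeg]))]
    refine if_congr ((isSemistandard_inl_iff _).trans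
      ⟨fun h => eq_rowDiagram lam.2 h, fun h x hx => ?_⟩) rfl rfl
    rw [h, mem_rowDiagram] at hx
    exact hx.1
  simp_rw [e]
  rw [Finset.sum_eq_single (⟨rowDiagram d.degree, card_rowDiagram _⟩ : Diagram d.degree)]
  · rw [if_pos rfl, mul_one, multiplicity_of_row _ _ fun x hx => (mem_rowDiagram.1 hx).1, hdeg]
  · intro lam _ hne
    rw [if_neg fun h => hne (Subtype.ext h), mul_zero]
  · simp

open Classical in
/-- The coefficients of `f` count the self-conjugate partitions in the hook `H(1, 1)`. -/
theorem coeff_f (n : ℕ) : PowerSeries.coeff n f =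
    (Finset.univ.filter fun μ : Diagram n =>
      InHook 1 1 μ.1 ∧ μ.1.transpose = μ.1).card := by
  rw [f, PowerSeries.coeff_mk]
  set d : Fin 0 ⊕ Fin 1 →₀ ℕ := Finsupp.single (Sum.inr 0) n with hd
  have hdeg : d.degree = n := by simp [hd]
  change ∑ lam : Diagram d.degree, multiplicity 1 1 lam * (hookSchur 0 1 lam.1).coeff d = _
  have hcol : ∀ x ∈ (rowDiagram d.degree).transpose, x.2 = 0 := fun x hx =>
    (mem_rowDiagram.1 (YoungDiagram.mem_transpose.1 hx)).1
  have e : ∀ lam : Diagram d.degree, (hookSchur 0 1 lam.1).coeff d =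
      if lam.1 = (rowDiagram d.degree).transpose then 1 else 0 := by
    intro lam
    rw [coeff_hookSchur_of_unique (s := Sum.inr 0)
      (fun t => by rcases t with t | t <;> fin_cases t; rfl)
      (hd.trans (by rw [lam.2.trans hdeg]))]
    refine if_congr ((isSemistandard_inr_iff _).trans
      ⟨fun h => eq_transpose_rowDiagram lam.2 h, fun h x hx => ?_⟩) rfl rfl
    rw [h] at hx
    exact hcol x hx
  simp_rw [e]
  rw [Finset.sum_eq_single (⟨(rowDiagram d.degree).transpose,
    (card_transpose _).trans (card_rowDiagram _)⟩ : Diagram d.degree)]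
  · rw [if_pos rfl, mul_one, multiplicity_of_col _ _ hcol, hdeg]
  · intro lam _ hne
    rw [if_neg fun h => hne (Subtype.ext h), mul_zero]
  · simp

/-! ### Counting partitions in the hooks `H(1, 1)` and `H(2, 2)` -/

/-- The hook with arm `a` and leg `c`. -/
def hook (a c : ℕ) : YoungDiagram where
  cells := {0} ×ˢ Finset.range (a + 1) ∪ Finset.Ico 1 (c + 1) ×ˢ {0}
  isLowerSet := by
    rintro ⟨i, j⟩ ⟨i', j'⟩ h hx
    simp only [Prod.mk_le_mk] at h
    simp at hx ⊢
    omega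

theorem mem_hook {a c i j : ℕ} : (i, j) ∈ hook a c ↔ (i = 0 ∧ j ≤ a) ∨ (j = 0 ∧ i ≤ c) := by
  rw [← YoungDiagram.mem_cells]
  simp [hook]
  omega

theorem card_hook (a c : ℕ) : (hook a c).card = a + c + 1 := by
  rw [YoungDiagram.card, hook, Finset.card_union_of_disjoint]
  · simp
    omega
  · rw [Finset.disjoint_left]
    rintro ⟨i, j⟩ h1 h2
    simp at h1 h2
    omega

theorem hook_transpose (a c : ℕ) : (hook a c).transpose = hook c a := by
  refine YoungDiagram.ext (Finset.ext ?_)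
  rintro ⟨i, j⟩
  rw [YoungDiagram.mem_cells, YoungDiagram.mem_cells, YoungDiagram.mem_transpose, Prod.swap_prod_mk,
    mem_hook, mem_hook]
  tauto

theorem rowLen_eq_of_forall_mem {μ : YoungDiagram} {i m : ℕ} (h : ∀ j, (i, j) ∈ μ ↔ j < m) :
    μ.rowLen i = m :=
  eq_of_forall_lt_iff fun j => by rw [← h, YoungDiagram.mem_iff_lt_rowLen]

theorem colLen_eq_of_forall_mem {μ : YoungDiagram} {j m : ℕ} (h : ∀ i, (i, j) ∈ μ ↔ i < m) :
    μ.colLen j = m :=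
  eq_of_forall_lt_iff fun i => by rw [← h, YoungDiagram.mem_iff_lt_colLen]

theorem rowLen_hook (a c : ℕ) : (hook a c).rowLen 0 = a + 1 :=
  rowLen_eq_of_forall_mem fun j => by rw [mem_hook]; omega

theorem colLen_hook (a c : ℕ) : (hook a c).colLen 0 = c + 1 :=
  colLen_eq_of_forall_mem fun j => by rw [mem_hook]; omega

theorem hook_inj {a c a' c' : ℕ} (h : hook a c = hook a' c') : a = a' ∧ c = c' := by
  have h1 := congrArg (fun μ => μ.rowLen 0) h
  have h2 := congrArg (fun μ => μ.colLen 0) h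
  simp only [rowLen_hook, colLen_hook] at h1 h2
  omega

theorem exists_eq_hook {μ : YoungDiagram} {m : ℕ} (hm : μ.card = m + 1) (h : (1, 1) ∉ μ) :
    ∃ a c, a + c = m ∧ μ = hook a c := by
  have h0 : (0, 0) ∈ μ := by
    obtain ⟨x, hx⟩ := Finset.card_pos.1 (show 0 < μ.cells.card by rw [← YoungDiagram.card]; omega)
    exact μ.up_left_mem (Nat.zero_le x.1) (Nat.zero_le x.2) ((YoungDiagram.mem_cells _).1 hx)
  have hr := YoungDiagram.mem_iff_lt_rowLen.1 h0
  have hc := YoungDiagram.mem_iff_lt_colLen.1 h0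
  have e : μ = hook (μ.rowLen 0 - 1) (μ.colLen 0 - 1) := by
    refine YoungDiagram.ext (Finset.ext ?_)
    rintro ⟨i, j⟩
    rw [YoungDiagram.mem_cells, YoungDiagram.mem_cells, mem_hook]
    constructor
    · intro hx
      rcases Nat.eq_zero_or_pos i with rfl | hi
      · have := YoungDiagram.mem_iff_lt_rowLen.1 hx
        omega
      rcases Nat.eq_zero_or_pos j with rfl | hj
      · have := YoungDiagram.mem_iff_lt_colLen.1 hx
        omega
      exact absurd (μ.up_left_mem hi hj hx) h
    · rintro (⟨rfl, hj⟩ | ⟨rfl, hi⟩)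
      · exact YoungDiagram.mem_iff_lt_rowLen.2 (by omega)
      · exact YoungDiagram.mem_iff_lt_colLen.2 (by omega)
  refine ⟨_, _, ?_, e⟩
  have := card_hook (μ.rowLen 0 - 1) (μ.colLen 0 - 1)
  rw [← e] at this
  omega

theorem eq_bot_of_card_eq_zero {μ : YoungDiagram} (h : μ.card = 0) : μ = ⊥ :=
  YoungDiagram.ext (by simpa using Finset.card_eq_zero.1 h)

theorem card_filter_diagram_zero {p : YoungDiagram → Prop}
    [DecidablePred fun μ : Diagram 0 => p μ.1] (hp : p ⊥) :
    (Finset.univ.filter fun μ : Diagram 0 => p μ.1).card = 1 := by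
  rw [Finset.card_eq_one]
  refine ⟨⟨⊥, rfl⟩, ?_⟩
  ext μ
  simp only [Finset.mem_filter, Finset.mem_univ, true_and, Finset.mem_singleton]
  constructor
  · intro _
    exact Subtype.ext (eq_bot_of_card_eq_zero μ.2)
  · rintro rfl
    exact hp

/-- Hooks with `m + 1` cells correspond to the ways of sharing the other `m` cells between arm and
leg. -/
theorem card_hook_filter (m : ℕ) (p : YoungDiagram → Prop) [DecidablePred p]
    [DecidablePred fun μ : Diagram (m + 1) => (1, 1) ∉ μ.1 ∧ p μ.1] :
    (Finset.univ.filter fun μ : Diagram (m + 1) => (1, 1) ∉ μ.1 ∧ p μ.1).card =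
      ((Finset.HasAntidiagonal.antidiagonal m).filter fun x => p (hook x.1 x.2)).card := by
  symm
  refine Finset.card_bij (fun x hx => ⟨hook x.1 x.2, ?_⟩) ?_ ?_ ?_
  · rw [card_hook, Finset.HasAntidiagonal.mem_antidiagonal.1 (Finset.mem_filter.1 hx).1]
  · intro x hx
    simp only [Finset.mem_filter, Finset.mem_univ, true_and]
    exact ⟨by rw [mem_hook]; omega, (Finset.mem_filter.1 hx).2⟩
  · intro x _ y _ h
    obtain ⟨h1, h2⟩ := hook_inj (congrArg Subtype.val h)
    exact Prod.ext h1 h2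
  · intro μ hμ
    simp only [Finset.mem_filter, Finset.mem_univ, true_and] at hμ
    obtain ⟨a, c, hac, e⟩ := exists_eq_hook μ.2 hμ.1
    exact ⟨(a, c), by simpa [hac, ← e] using hμ.2, Subtype.ext e.symm⟩

theorem inHook_one_one_iff {μ : YoungDiagram} : InHook 1 1 μ ↔ (1, 1) ∉ μ := by
  rw [InHook, YoungDiagram.mem_iff_lt_rowLen, not_lt]

open Classical in
theorem card_selfConjugate_hook_succ (m : ℕ) :
    (Finset.univ.filter fun μ : Diagram (m + 1) =>
      InHook 1 1 μ.1 ∧ μ.1.transpose = μ.1).card = if Even m then 1 else 0 := by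
  simp_rw [inHook_one_one_iff]
  rw [card_hook_filter m fun μ => μ.transpose = μ]
  have e : ∀ x : ℕ × ℕ, (hook x.1 x.2).transpose = hook x.1 x.2 ↔ x.1 = x.2 := by
    intro x
    rw [hook_transpose]
    exact ⟨fun h => (hook_inj h).2, fun h => by rw [h]⟩
  simp_rw [e]
  split_ifs with hm
  · obtain ⟨k, rfl⟩ := hm
    rw [Finset.card_eq_one]
    refine ⟨(k, k), ?_⟩
    ext ⟨a, c⟩
    simp only [Finset.mem_filter, Finset.HasAntidiagonal.mem_antidiagonal,
      Finset.mem_singleton, Prod.mk.injEq]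
    omega
  · rw [Finset.card_eq_zero, Finset.filter_eq_empty_iff]
    rintro ⟨a, c⟩ hac h
    rw [Finset.HasAntidiagonal.mem_antidiagonal] at hac
    exact hm ⟨a, by simp only at hac h; omega⟩

/-- The diagram with first two rows `a + b + 2`, `b + 2` and first two columns `c + d + 2`,
`d + 2`, and no other cells. -/
def doubleHook (a b c d : ℕ) : YoungDiagram where
  cells := {0} ×ˢ Finset.range (a + b + 2) ∪ {1} ×ˢ Finset.range (b + 2) ∪
    (Finset.Ico 2 (c + d + 2) ×ˢ {0} ∪ Finset.Ico 2 (d + 2) ×ˢ {1})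
  isLowerSet := by
    rintro ⟨i, j⟩ ⟨i', j'⟩ h hx
    simp only [Prod.mk_le_mk] at h
    simp at hx ⊢
    omega

theorem mem_doubleHook {a b c d i j : ℕ} : (i, j) ∈ doubleHook a b c d ↔
    (i = 0 ∧ j < a + b + 2) ∨ (i = 1 ∧ j < b + 2) ∨ (j = 0 ∧ i < c + d + 2) ∨
      (j = 1 ∧ i < d + 2) := by
  rw [← YoungDiagram.mem_cells]
  simp [doubleHook]
  omega

theorem card_doubleHook (a b c d : ℕ) :
    (doubleHook a b c d).card = a + 2 * b + (c + 2 * d) + 4 := by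
  rw [YoungDiagram.card, doubleHook, Finset.card_union_of_disjoint, Finset.card_union_of_disjoint,
    Finset.card_union_of_disjoint]
  · simp
    omega
  all_goals
    rw [Finset.disjoint_left]
    rintro ⟨i, j⟩ h1 h2
    simp at h1 h2
    omega

theorem doubleHook_inj {a b c d a' b' c' d' : ℕ}
    (h : doubleHook a b c d = doubleHook a' b' c' d') :
    a = a' ∧ b = b' ∧ c = c' ∧ d = d' := by
  have r0 : ∀ a b c d, (doubleHook a b c d).rowLen 0 = a + b + 2 := fun a b c d =>
    rowLen_eq_of_forall_mem fun j => by rw [mem_doubleHook]; omega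
  have r1 : ∀ a b c d, (doubleHook a b c d).rowLen 1 = b + 2 := fun a b c d =>
    rowLen_eq_of_forall_mem fun j => by rw [mem_doubleHook]; omega
  have c0 : ∀ a b c d, (doubleHook a b c d).colLen 0 = c + d + 2 := fun a b c d =>
    colLen_eq_of_forall_mem fun j => by rw [mem_doubleHook]; omega
  have c1 : ∀ a b c d, (doubleHook a b c d).colLen 1 = d + 2 := fun a b c d =>
    colLen_eq_of_forall_mem fun j => by rw [mem_doubleHook]; omega
  have h1 := congrArg (fun μ => μ.rowLen 0) h
  have h2 := congrArg (fun μ => μ.rowLen 1) h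
  have h3 := congrArg (fun μ => μ.colLen 0) h
  have h4 := congrArg (fun μ => μ.colLen 1) h
  simp only [r0, r1, c0, c1] at h1 h2 h3 h4
  omega

theorem exists_eq_doubleHook {μ : YoungDiagram} (h : InHook 2 2 μ) (h1 : (1, 1) ∈ μ) :
    ∃ a b c d, μ = doubleHook a b c d := by
  have hr := YoungDiagram.mem_iff_lt_rowLen.1 h1
  have hc := YoungDiagram.mem_iff_lt_colLen.1 h1
  have hr' := μ.rowLen_anti 0 1 (Nat.zero_le 1)
  have hc' := μ.colLen_anti 0 1 (Nat.zero_le 1)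
  refine ⟨μ.rowLen 0 - μ.rowLen 1, μ.rowLen 1 - 2, μ.colLen 0 - μ.colLen 1, μ.colLen 1 - 2, ?_⟩
  refine YoungDiagram.ext (Finset.ext ?_)
  rintro ⟨i, j⟩
  rw [YoungDiagram.mem_cells, YoungDiagram.mem_cells, mem_doubleHook]
  constructor
  · intro hx
    have hxr := YoungDiagram.mem_iff_lt_rowLen.1 hx
    have hxc := YoungDiagram.mem_iff_lt_colLen.1 hx
    rcases Nat.lt_or_ge i 2 with hi | hi
    · interval_cases i <;> omega
    · have := (μ.rowLen_anti 2 i hi).trans h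
      have hj : j < 2 := by omega
      interval_cases j <;> omega
  · rintro (⟨rfl, hj⟩ | ⟨rfl, hj⟩ | ⟨rfl, hi⟩ | ⟨rfl, hi⟩)
    · exact YoungDiagram.mem_iff_lt_rowLen.2 (by omega)
    · exact YoungDiagram.mem_iff_lt_rowLen.2 (by omega)
    · exact YoungDiagram.mem_iff_lt_colLen.2 (by omega)
    · exact YoungDiagram.mem_iff_lt_colLen.2 (by omega)

open Classical in
/-- The two pairs of rows and columns beyond the central square of `H(2, 2)`-partitions are two
independent partitions with at most two parts; there are `i / 2 + 1` such partitions of `i`. -/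
theorem card_doubleHook_filter (m : ℕ) :
    (Finset.univ.filter fun μ : Diagram (m + 4) => InHook 2 2 μ.1 ∧ (1, 1) ∈ μ.1).card =
      ∑ x ∈ Finset.HasAntidiagonal.antidiagonal m, (x.1 / 2 + 1) * (x.2 / 2 + 1) := by
  have : ∑ x ∈ Finset.HasAntidiagonal.antidiagonal m, (x.1 / 2 + 1) * (x.2 / 2 + 1) =
      ((Finset.HasAntidiagonal.antidiagonal m).sigma fun x =>
        Finset.range (x.1 / 2 + 1) ×ˢ Finset.range (x.2 / 2 + 1)).card := by
    rw [Finset.card_sigma]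
    simp
  rw [this]
  symm
  refine Finset.card_bij (fun x hx =>
    ⟨doubleHook (x.1.1 - 2 * x.2.1) x.2.1 (x.1.2 - 2 * x.2.2) x.2.2, ?_⟩) ?_ ?_ ?_
  · simp only [Finset.mem_sigma, Finset.HasAntidiagonal.mem_antidiagonal, Finset.mem_product,
      Finset.mem_range] at hx
    rw [card_doubleHook]
    omega
  · intro x hx
    simp only [Finset.mem_filter, Finset.mem_univ, true_and]
    constructor
    · rw [InHook, ← not_lt, ← YoungDiagram.mem_iff_lt_rowLen, mem_doubleHook]
      omega
    · rw [mem_doubleHook]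
      omega
  · rintro ⟨⟨i, j⟩, b, d⟩ hx ⟨⟨i', j'⟩, b', d'⟩ hy h
    obtain ⟨h1, h2, h3, h4⟩ := doubleHook_inj (congrArg Subtype.val h)
    simp only [Finset.mem_sigma, Finset.HasAntidiagonal.mem_antidiagonal, Finset.mem_product,
      Finset.mem_range] at hx hy h1 h2 h3 h4
    obtain rfl : i = i' := by omega
    obtain rfl : j = j' := by omega
    rw [h2, h4]
  · intro μ hμ
    simp only [Finset.mem_filter, Finset.mem_univ, true_and] at hμ
    obtain ⟨a, b, c, d, e⟩ := exists_eq_doubleHook hμ.1 hμ.2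
    have hcard := card_doubleHook a b c d
    rw [← e, μ.2] at hcard
    refine ⟨⟨(a + 2 * b, c + 2 * d), b, d⟩, ?_, Subtype.ext ?_⟩
    · simp only [Finset.mem_sigma, Finset.HasAntidiagonal.mem_antidiagonal, Finset.mem_product,
        Finset.mem_range]
      omega
    · simp [e]

open Classical in
theorem card_doubleHook_filter_of_lt {n : ℕ} (hn : n < 4) :
    (Finset.univ.filter fun μ : Diagram n => InHook 2 2 μ.1 ∧ (1, 1) ∈ μ.1).card = 0 := by
  rw [Finset.card_eq_zero, Finset.filter_eq_empty_iff]
  rintro μ - ⟨h, h1⟩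
  obtain ⟨a, b, c, d, e⟩ := exists_eq_doubleHook h h1
  have hcard := card_doubleHook a b c d
  rw [← e, μ.2] at hcard
  omega

open Classical in
theorem card_inHook_two_two (n : ℕ) :
    (Finset.univ.filter fun μ : Diagram n => InHook 2 2 μ.1).card =
      (Finset.univ.filter fun μ : Diagram n => (1, 1) ∉ μ.1 ∧ True).card +
      (Finset.univ.filter fun μ : Diagram n => InHook 2 2 μ.1 ∧ (1, 1) ∈ μ.1).card := by
  rw [← Finset.card_union_of_disjoint]
  · congr 1
    ext μ
    simp only [Finset.mem_filter, Finset.mem_univ, true_and, Finset.mem_union, and_true]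
    constructor
    · intro h
      tauto
    · rintro (h | h)
      · rw [YoungDiagram.mem_iff_lt_rowLen, not_lt] at h
        exact ((μ.1.rowLen_anti 1 2 (by norm_num)).trans h).trans (by norm_num)
      · exact h.1
  · rw [Finset.disjoint_left]
    intro μ h1 h2
    exact (Finset.mem_filter.1 h1).2.1 (Finset.mem_filter.1 h2).2.2

/-! ### The two power series -/

theorem f_mul : f * (1 - PowerSeries.X ^ 2) = 1 + PowerSeries.X - PowerSeries.X ^ 2 := by
  classical
  have h0 : PowerSeries.coeff 0 f = 1 := by
    rw [coeff_f, card_filter_diagram_zero (p := fun μ => InHook 1 1 μ ∧ μ.transpose = μ),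
      Nat.cast_one]
    constructor
    · rw [inHook_one_one_iff]
      exact YoungDiagram.notMem_bot _
    · exact eq_bot_of_card_eq_zero ((card_transpose _).trans rfl)
  have hs : ∀ m, PowerSeries.coeff (m + 1) f = if Even m then 1 else 0 := by
    intro m
    rw [coeff_f, card_selfConjugate_hook_succ]
    split_ifs <;> simp
  ext n
  rw [mul_sub, mul_one, map_sub, map_sub, map_add, PowerSeries.coeff_mul_X_pow',
    PowerSeries.coeff_one, PowerSeries.coeff_X, PowerSeries.coeff_X_pow]
  rcases n with _ | _ | _ | m
  · simp [h0]
  · simp [hs]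
  · simp [hs, h0]
  · rw [hs, if_pos (show 2 ≤ m + 1 + 1 + 1 by omega), show m + 1 + 1 + 1 - 2 = m + 1 by omega, hs]
    simp [Nat.even_add_one]

/-- The generating function of the number `n / 2 + 1` of partitions of `n` into at most two
parts. -/
theorem mk_half_mul :
    (PowerSeries.mk fun n => ((n / 2 + 1 : ℕ) : ℂ)) *
      ((1 - PowerSeries.X) * (1 - PowerSeries.X ^ 2)) = 1 := by
  set F : PowerSeries ℂ := PowerSeries.mk fun n => ((n / 2 + 1 : ℕ) : ℂ) with hF
  have e : F * ((1 - PowerSeries.X) * (1 - PowerSeries.X ^ 2)) =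
      F - F * PowerSeries.X ^ 1 - F * PowerSeries.X ^ 2 + F * PowerSeries.X ^ 3 := by ring
  rw [e]
  ext n
  simp only [map_sub, map_add, PowerSeries.coeff_mul_X_pow', PowerSeries.coeff_one, hF,
    PowerSeries.coeff_mk]
  rcases n with _ | _ | _ | m
  · simp
  · simp
  · norm_num
  · rw [if_pos (by omega), if_pos (by omega), if_pos (by omega), if_neg (by omega),
      show m + 1 + 1 + 1 - 1 = m + 2 by omega, show m + 1 + 1 + 1 - 2 = m + 1 by omega,
      show m + 1 + 1 + 1 - 3 = m by omega, show (m + 1 + 1 + 1) / 2 = (m + 1) / 2 + 1 by omega,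
      show (m + 2) / 2 = m / 2 + 1 by omega]
    push_cast
    ring

theorem mk_one_mul : (PowerSeries.mk fun _ => (1 : ℂ)) * (1 - PowerSeries.X) = 1 :=
  PowerSeries.mk_one_mul_one_sub_eq_one ℂ

/-- Sorting the partitions of `H(2, 2)` by whether they contain the cell `(1, 1)`. -/
theorem g_eq : g = 1 + PowerSeries.X * ((PowerSeries.mk fun _ => (1 : ℂ)) *
      PowerSeries.mk fun _ => (1 : ℂ)) +
    PowerSeries.X ^ 4 * ((PowerSeries.mk fun n => ((n / 2 + 1 : ℕ) : ℂ)) *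
      PowerSeries.mk fun n => ((n / 2 + 1 : ℕ) : ℂ)) := by
  classical
  ext n
  rw [coeff_g, card_inHook_two_two, Nat.cast_add, map_add]
  congr 1
  · rcases n with _ | m
    · rw [card_filter_diagram_zero (p := fun μ => (1, 1) ∉ μ ∧ True)
        ⟨YoungDiagram.notMem_bot _, trivial⟩]
      simp
    · rw [card_hook_filter m fun _ => True, map_add, PowerSeries.coeff_succ_X_mul,
        PowerSeries.coeff_mul]
      simp [PowerSeries.coeff_one]
  · rw [PowerSeries.coeff_X_pow_mul']
    split_ifs with hn
    · obtain ⟨m, rfl⟩ := Nat.exists_eq_add_of_le' hn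
      rw [card_doubleHook_filter, Nat.add_sub_cancel, PowerSeries.coeff_mul]
      simp
    · rw [card_doubleHook_filter_of_lt (not_le.1 hn), Nat.cast_zero]

theorem g_mul : g * ((1 - PowerSeries.X) ^ 2 * (1 - PowerSeries.X ^ 2) ^ 2) =
    1 - PowerSeries.X - PowerSeries.X ^ 2 + 2 * PowerSeries.X ^ 3 - PowerSeries.X ^ 5 +
      PowerSeries.X ^ 6 := by
  have h1 := mk_one_mul
  have h2 := mk_half_mul
  rw [g_eq]
  generalize (PowerSeries.mk fun _ => (1 : ℂ)) = H at *
  generalize (PowerSeries.mk fun n => ((n / 2 + 1 : ℕ) : ℂ)) = F at *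
  linear_combination
    (PowerSeries.X * (1 - PowerSeries.X ^ 2) ^ 2 * (H * (1 - PowerSeries.X) + 1)) * h1 +
    (PowerSeries.X ^ 4 * (F * ((1 - PowerSeries.X) * (1 - PowerSeries.X ^ 2)) + 1)) * h2

/-! ### Rational functions -/

open Polynomial in
/-- A power series identity `s * q = p` identifies `s` with the expansion of `p / q`. -/
theorem coe_eq_of_mul_eq {s : PowerSeries ℂ} {p q : ℂ[X]} (hq : q ≠ 0)
    (h : s * (q : PowerSeries ℂ) = p) :
    (s : ℂ⸨X⸩) = ((algebraMap ℂ[X] (RatFunc ℂ) p / algebraMap ℂ[X] (RatFunc ℂ) q :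
      RatFunc ℂ) : ℂ⸨X⸩) := by
  have hc : ∀ r : ℂ[X], ((algebraMap ℂ[X] (RatFunc ℂ) r : RatFunc ℂ) : ℂ⸨X⸩) =
      ((r : PowerSeries ℂ) : ℂ⸨X⸩) := by
    intro r
    rw [RatFunc.coe_coe, RatFunc.coePolynomial_eq_algebraMap]
  rw [map_div₀, hc, hc, eq_div_iff, ← PowerSeries.coe_mul, h]
  rw [← hc, Ne, map_eq_zero]
  exact RatFunc.algebraMap_ne_zero hq

open Polynomial in
/-- Substituting `X⁻¹` into a fraction. The denominator cannot vanish there because `X⁻¹` is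
transcendental. -/
theorem eval_inv_X_div {p q : ℂ[X]} (hq : q ≠ 0) :
    RatFunc.eval RatFunc.C (RatFunc.X⁻¹ : RatFunc ℂ)
      (algebraMap ℂ[X] (RatFunc ℂ) p / algebraMap ℂ[X] (RatFunc ℂ) q) =
    p.eval₂ RatFunc.C (RatFunc.X⁻¹) / q.eval₂ RatFunc.C (RatFunc.X⁻¹) := by
  have htr : Transcendental ℂ (RatFunc.X⁻¹ : RatFunc ℂ) := fun h =>
    RatFunc.transcendental_X (IsAlgebraic.inv_iff.1 h)
  have hne : ∀ r : ℂ[X], r ≠ 0 → r.eval₂ RatFunc.C (RatFunc.X⁻¹ : RatFunc ℂ) ≠ 0 := by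
    intro r hr h0
    refine hr ((transcendental_iff.1 htr) r ?_)
    rw [aeval_def]
    exact h0
  set x : RatFunc ℂ := algebraMap ℂ[X] (RatFunc ℂ) p / algebraMap ℂ[X] (RatFunc ℂ) q with hx
  have h : x.num * q = p * x.denom := (RatFunc.num_mul_eq_mul_denom_iff hq).2 hx
  rw [RatFunc.eval, div_eq_div_iff (hne _ (RatFunc.denom_ne_zero x)) (hne q hq), ← eval₂_mul, h,
    eval₂_mul]

open Polynomial in
/-- Clearing denominators in the functional equation of `p / q`, when `q` is palindromic or
antipalindromic and `p'` is the reverse of `p`. -/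
theorem SatisfiesFunctionalEquation.exists_mul_eq {p q p' : ℂ[X]} {N : ℕ} {δ : ℂ} (hq : q ≠ 0)
    (hδ : δ ^ 2 = 1)
    (hp' : p.eval₂ RatFunc.C (RatFunc.X⁻¹ : RatFunc ℂ) * RatFunc.X ^ N =
      algebraMap ℂ[X] (RatFunc ℂ) p')
    (hq' : q.eval₂ RatFunc.C (RatFunc.X⁻¹ : RatFunc ℂ) * RatFunc.X ^ N =
      algebraMap ℂ[X] (RatFunc ℂ) (C δ * q))
    (h : SatisfiesFunctionalEquation
      (algebraMap ℂ[X] (RatFunc ℂ) p / algebraMap ℂ[X] (RatFunc ℂ) q)) :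
    ∃ (k m : ℕ) (ε : ℂ), ε ^ 2 = 1 ∧ X ^ k * p' = C ε * X ^ m * p := by
  obtain ⟨e, he⟩ := h
  have hX : (RatFunc.X : RatFunc ℂ) ≠ 0 := RatFunc.X_ne_zero
  have hq0 : algebraMap ℂ[X] (RatFunc ℂ) q ≠ 0 := RatFunc.algebraMap_ne_zero hq
  have hδ0 : δ ≠ 0 := by
    rintro rfl
    simp at hδ
  have hC0 : algebraMap ℂ[X] (RatFunc ℂ) (C δ) ≠ 0 :=
    RatFunc.algebraMap_ne_zero (C_ne_zero.2 hδ0)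
  have hev : RatFunc.eval RatFunc.C (RatFunc.X⁻¹ : RatFunc ℂ)
      (algebraMap ℂ[X] (RatFunc ℂ) p / algebraMap ℂ[X] (RatFunc ℂ) q) =
      algebraMap ℂ[X] (RatFunc ℂ) p' /
        (algebraMap ℂ[X] (RatFunc ℂ) (C δ) * algebraMap ℂ[X] (RatFunc ℂ) q) := by
    rw [eval_inv_X_div hq, ← map_mul, ← hp', ← hq', mul_div_mul_right _ _ (pow_ne_zero N hX)]
  obtain ⟨ε, hε, he'⟩ : ∃ ε : ℂ, ε ^ 2 = 1 ∧ RatFunc.eval RatFunc.C (RatFunc.X⁻¹ : RatFunc ℂ)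
      (algebraMap ℂ[X] (RatFunc ℂ) p / algebraMap ℂ[X] (RatFunc ℂ) q) =
      algebraMap ℂ[X] (RatFunc ℂ) (C ε) * (RatFunc.X ^ e *
        (algebraMap ℂ[X] (RatFunc ℂ) p / algebraMap ℂ[X] (RatFunc ℂ) q)) := by
    rcases he with he | he
    · exact ⟨1, by norm_num, by rw [he]; simp⟩
    · exact ⟨-1, by norm_num, by rw [he]; simp⟩
  rw [hev] at he'
  refine ⟨(-e).toNat, e.toNat, ε * δ, by rw [mul_pow, hε, hδ, one_mul], ?_⟩
  apply RatFunc.algebraMap_injective ℂ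
  have hz : (RatFunc.X : RatFunc ℂ) ^ (-e).toNat * RatFunc.X ^ e = RatFunc.X ^ e.toNat := by
    rw [← zpow_natCast, ← zpow_natCast, ← zpow_add₀ hX]
    congr 1
    omega
  simp only [map_mul, map_pow, RatFunc.algebraMap_X]
  rw [← hz]
  field_simp at he'
  rw [he']
  ring

open Polynomial in
theorem not_functionalEquation_f {h : RatFunc ℂ}
    (hh : h = (1 + RatFunc.X - RatFunc.X ^ 2) / (1 - RatFunc.X ^ 2)) :
    ¬ SatisfiesFunctionalEquation h := by
  intro hfe
  have hX : (RatFunc.X : RatFunc ℂ) ≠ 0 := RatFunc.X_ne_zero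
  have e : h = algebraMap ℂ[X] (RatFunc ℂ) (1 + X - X ^ 2) /
      algebraMap ℂ[X] (RatFunc ℂ) (1 - X ^ 2) := by
    rw [hh]
    simp
  rw [e] at hfe
  have hq : (1 - X ^ 2 : ℂ[X]) ≠ 0 := by
    intro h0
    have := congrArg (eval 0) h0
    simp at this
  obtain ⟨k, m, ε, -, h1⟩ := hfe.exists_mul_eq (p' := X ^ 2 + X - 1) (N := 2) (δ := -1) hq
    (by norm_num)
    (by
      simp
      field_simp)
    (by
      simp
      field_simp)
  -- the value at `1` determines the sign, and then the value at `2` gives a contradiction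
  have v1 := congrArg (eval 1) h1
  have v2 := congrArg (eval 2) h1
  simp at v1
  simp [← v1] at v2
  have v3 : ((2 ^ k * 5 + 2 ^ m : ℕ) : ℂ) = 0 := by
    push_cast
    linear_combination v2
  have h0 := Nat.cast_eq_zero.1 v3
  have hpos : 0 < 2 ^ k * 5 + 2 ^ m := by positivity
  exact hpos.ne' h0

open Polynomial in
theorem not_functionalEquation_g {h : RatFunc ℂ}
    (hh : h = (1 - RatFunc.X - RatFunc.X ^ 2 + 2 * RatFunc.X ^ 3 - RatFunc.X ^ 5 + RatFunc.X ^ 6) /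
      ((1 - RatFunc.X) ^ 2 * (1 - RatFunc.X ^ 2) ^ 2)) :
    ¬ SatisfiesFunctionalEquation h := by
  intro hfe
  have h2 : algebraMap ℂ[X] (RatFunc ℂ) 2 = 2 := map_ofNat _ 2
  have hX : (RatFunc.X : RatFunc ℂ) ≠ 0 := RatFunc.X_ne_zero
  have e : h = algebraMap ℂ[X] (RatFunc ℂ) (1 - X - X ^ 2 + 2 * X ^ 3 - X ^ 5 + X ^ 6) /
      algebraMap ℂ[X] (RatFunc ℂ) ((1 - X) ^ 2 * (1 - X ^ 2) ^ 2) := by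
    rw [hh]
    simp [h2]
  rw [e] at hfe
  have hq : ((1 - X) ^ 2 * (1 - X ^ 2) ^ 2 : ℂ[X]) ≠ 0 := by
    intro h0
    have := congrArg (eval 0) h0
    simp at this
  obtain ⟨k, m, ε, -, h1⟩ := hfe.exists_mul_eq
    (p' := X ^ 6 - X ^ 5 - X ^ 4 + 2 * X ^ 3 - X + 1) (N := 6) (δ := 1) hq
    (by norm_num)
    (by
      simp [h2, eval₂_mul, eval₂_pow]
      field_simp)
    (by
      simp [eval₂_mul, eval₂_pow]
      field_simp
      ring)
  -- the value at `1` determines the sign, and the values at `2` are `31` and `43`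
  have v1 := congrArg (eval 1) h1
  have v2 := congrArg (eval 2) h1
  norm_num at v1
  norm_num [← v1] at v2
  have v3 : 2 ^ k * 31 = 2 ^ m * 43 := by exact_mod_cast v2
  have hdvd : 43 ∣ 2 ^ k * 31 := ⟨2 ^ m, by rw [v3, mul_comm]⟩
  have hp : Nat.Prime 43 := by norm_num
  rcases hp.dvd_mul.1 hdvd with hd | hd
  · have := hp.dvd_of_dvd_pow hd
    omega
  · omega

open Polynomial in
theorem coe_f : (f : ℂ⸨X⸩) =
    (((1 + RatFunc.X - RatFunc.X ^ 2) / (1 - RatFunc.X ^ 2) : RatFunc ℂ) : ℂ⸨X⸩) := by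
  rw [coe_eq_of_mul_eq (s := f) (p := 1 + X - X ^ 2) (q := 1 - X ^ 2)]
  · simp
  · intro h0
    have := congrArg (eval 0) h0
    simp at this
  · simpa using f_mul

open Polynomial in
theorem coe_g : (g : ℂ⸨X⸩) =
    (((1 - RatFunc.X - RatFunc.X ^ 2 + 2 * RatFunc.X ^ 3 - RatFunc.X ^ 5 + RatFunc.X ^ 6) /
      ((1 - RatFunc.X) ^ 2 * (1 - RatFunc.X ^ 2) ^ 2) : RatFunc ℂ) : ℂ⸨X⸩) := by
  have h2 : algebraMap ℂ[X] (RatFunc ℂ) 2 = 2 := map_ofNat _ 2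
  have h2' : ((2 : ℂ[X]) : PowerSeries ℂ) = 2 :=
    map_ofNat (Polynomial.coeToPowerSeries.ringHom (R := ℂ)) 2
  rw [coe_eq_of_mul_eq (s := g) (p := 1 - X - X ^ 2 + 2 * X ^ 3 - X ^ 5 + X ^ 6)
    (q := (1 - X) ^ 2 * (1 - X ^ 2) ^ 2)]
  · simp [h2]
  · intro h0
    have := congrArg (eval 0) h0
    simp at this
  · simpa [h2'] using g_mul

end SuperInvariants

theorem corollary4p3 :
    ((SuperInvariants.f : ℂ⸨X⸩) =
        (((1 + RatFunc.X - RatFunc.X ^ 2) / (1 - RatFunc.X ^ 2) : RatFunc ℂ) : ℂ⸨X⸩)) ∧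
      ((SuperInvariants.g : ℂ⸨X⸩) =
        (((1 - RatFunc.X - RatFunc.X ^ 2 + 2 * RatFunc.X ^ 3 - RatFunc.X ^ 5 + RatFunc.X ^ 6) /
          ((1 - RatFunc.X) ^ 2 * (1 - RatFunc.X ^ 2) ^ 2) : RatFunc ℂ) : ℂ⸨X⸩)) ∧
      ∀ h : RatFunc ℂ,
        ((h : ℂ⸨X⸩) = (SuperInvariants.f : ℂ⸨X⸩) ∨ (h : ℂ⸨X⸩) = (SuperInvariants.g : ℂ⸨X⸩)) →
          ¬ SuperInvariants.SatisfiesFunctionalEquation h := by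
  have hinj : Function.Injective fun h : RatFunc ℂ => (h : ℂ⸨X⸩) := RingHom.injective _
  refine ⟨SuperInvariants.coe_f, SuperInvariants.coe_g, ?_⟩
  rintro h (hf | hg)
  · exact SuperInvariants.not_functionalEquation_f (hinj (hf.trans SuperInvariants.coe_f))
  · exact SuperInvariants.not_functionalEquation_g (hinj (hg.trans SuperInvariants.coe_g))
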